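/- **Theorem (Chaitin incompleteness).** For a partial computable function $A:\{0,1\}^*\to\{0,1\}^*$ let $K_A(x)=\min\{|p| : A(p)=x\}$ (with $\min\emptyset=+\infty$). Let $U:\{0,1\}^*\to\{0,1\}^*$ be an optimal partial computable function, i.e. for every partial computable $A$ there is a constant $d$ with $K_U(x)\le K_A(x)+d$ for all $x$; write $K=K_U$. Fix an algorithm computing $U$, and for a binary string $x$ and $n\in\mathbb N$ let "$K(x)\ge n$" denote the sentence of first-order arithmetic (language $0,S,+,\cdot$) that says, through the standard arithmetization of this algorithm, that no program $p$ with $|p|<n$ has output $x$. Let $\mathcal T$ be a first-order theory in the language of arithmetic whose set of axioms is computably enumerable (in particular, $\mathcal T$ may be any theory with a computable set of axioms), which contains Peano arithmetic (every axiom of Peano arithmetic is a theorem of $\mathcal T$), and all of whose axioms are true in the standard model $\mathbb N$. Then there is a constant $c\in\mathbb N$ such that for every binary string $x$ and every $n\in\mathbb N$: if $\mathcal T$ proves "$K(x)\ge n$", then $n\le c$. -/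

import Mathlib

open scoped FirstOrder

namespace Chaitin

open FirstOrder FirstOrder.Language
open Nat.Partrec (Code)

/-! ### Kolmogorov complexity -/

/-- `K_A(x) = min {|p| : A(p) = x}`, with `min ∅ = +∞`. -/
noncomputable def K (A : List Bool →. List Bool) (x : List Bool) : ℕ∞ :=
  ⨅ (p : List Bool) (_ : x ∈ A p), (p.length : ℕ∞)

/-- A partial computable `U` whose complexity `K_U` is smallest up to an additive constant. -/
def IsOptimal (U : List Bool →. List Bool) : Prop :=
  Partrec U ∧ ∀ A : List Bool →. List Bool, Partrec A → ∃ c : ℕ, ∀ x, K U x ≤ K A x + c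

/-- The bijection between binary strings and natural numbers (bijective base 2, least significant
digit first); the strings of length less than `n` are those whose number is less than
`2 ^ n - 1`. -/
def strNum : List Bool → ℕ
  | [] => 0
  | b :: w => 2 * strNum w + 1 + b.toNat

/-- The algorithm `u` computes the partial function `A` on strings, through `strNum`. -/
def Computes (u : Code) (A : List Bool →. List Bool) : Prop :=
  ∀ p, u.eval (strNum p) = (A p).map strNum

/-! ### The language of first-order arithmetic and its standard model -/

/-- The function symbols `0`, `S`, `+`, `·`. -/
inductive ArithFunc : ℕ → Type
  | zero : ArithFunc 0
  | succ : ArithFunc 1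
  | add : ArithFunc 2
  | mul : ArithFunc 2

/-- The language `0, S, +, ·` (with equality) of Peano arithmetic. -/
def arith : FirstOrder.Language.{0, 0} := ⟨ArithFunc, fun _ => Empty⟩

/-- The standard model. -/
instance standardModel : arith.Structure ℕ where
  funMap {n} (f : ArithFunc n) := match n, f with
    | _, .zero => fun _ => 0
    | _, .succ => fun v => v 0 + 1
    | _, .add => fun v => v 0 + v 1
    | _, .mul => fun v => v 0 * v 1
  RelMap r := Empty.elim r

section Terms

variable {β : Type}

instance : Zero (arith.Term β) := ⟨Constants.term (L := arith) ArithFunc.zero⟩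
instance : Add (arith.Term β) := ⟨Functions.apply₂ (L := arith) ArithFunc.add⟩
instance : Mul (arith.Term β) := ⟨Functions.apply₂ (L := arith) ArithFunc.mul⟩

/-- The successor of a term. -/
def succ (t : arith.Term β) : arith.Term β := Functions.apply₁ (L := arith) ArithFunc.succ t

/-- The numeral `S … S 0`. -/
def num : ℕ → arith.Term β
  | 0 => 0
  | k + 1 => succ (num k)

end Terms

/-! ### Gödel numbers -/

/-- The Gödel number of a term. -/
def termCode {α : Type} [Encodable α] {n : ℕ} : arith.Term (α ⊕ Fin n) → ℕ
  | .var (.inl a) => Nat.pair 0 (Encodable.encode a)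
  | .var (.inr i) => Nat.pair 1 i
  | .func ArithFunc.zero _ => Nat.pair 2 0
  | .func ArithFunc.succ ts => Nat.pair 3 (termCode (ts 0))
  | .func ArithFunc.add ts => Nat.pair 4 (Nat.pair (termCode (ts 0)) (termCode (ts 1)))
  | .func ArithFunc.mul ts => Nat.pair 5 (Nat.pair (termCode (ts 0)) (termCode (ts 1)))

/-- The Gödel number of a formula. -/
def formulaCode {α : Type} [Encodable α] : {n : ℕ} → arith.BoundedFormula α n → ℕ
  | _, .falsum => Nat.pair 0 0
  | _, .equal s t => Nat.pair 1 (Nat.pair (termCode s) (termCode t))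
  | _, .rel R _ => Empty.elim R
  | _, .imp φ ψ => Nat.pair 2 (Nat.pair (formulaCode φ) (formulaCode ψ))
  | _, .all φ => Nat.pair 3 (formulaCode φ)

/-- The set of (Gödel numbers of) axioms of `T` is computably enumerable. -/
def IsComputablyEnumerable (T : arith.Theory) : Prop :=
  REPred fun k : ℕ => ∃ σ : arith.Sentence, σ ∈ T ∧ formulaCode σ = k

/-! ### Formal proofs

The variables named by natural numbers are the free variables of an `arith.Formula ℕ`. -/

/-- In a term, replace the outermost bound variable by `t`. -/
def instTerm {n : ℕ} (t : arith.Term ℕ) (s : arith.Term (ℕ ⊕ Fin (n + 1))) :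
    arith.Term (ℕ ⊕ Fin n) :=
  s.subst (Sum.elim (fun a => .var (.inl a))
    (Fin.cases (t.relabel Sum.inl) fun i => .var (.inr i)))

/-- In a formula, replace the outermost bound variable by `t`. For `φ : arith.BoundedFormula ℕ 1`,
this is the instance `φ(t)` of the formula `∀ x, φ(x)`. -/
def inst (t : arith.Term ℕ) : {n : ℕ} → arith.BoundedFormula ℕ (n + 1) → arith.BoundedFormula ℕ n
  | _, .falsum => .falsum
  | _, .equal s₁ s₂ => .equal (instTerm t s₁) (instTerm t s₂)
  | _, .rel R ts => .rel R fun i => instTerm t (ts i)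
  | _, .imp φ ψ => .imp (inst t φ) (inst t ψ)
  | _, .all φ => .all (inst t φ)

/-- A free variable seen as a term. -/
def fvar (a : ℕ) : arith.Term ℕ := .var a

/-- Equality of two terms without bound variables, as a formula. -/
def eqn (s t : arith.Term ℕ) : arith.Formula ℕ := Term.equal s t

/-- A formula without free named variables, in particular a sentence, seen as one whose free
variables are named by natural numbers. -/
def embed : {n : ℕ} → arith.BoundedFormula Empty n → arith.BoundedFormula ℕ n
  | _, .falsum => .falsum
  | _, .equal s t =>
      .equal (s.relabel (Sum.map Empty.elim id)) (t.relabel (Sum.map Empty.elim id))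
  | _, .rel R ts => .rel R fun i => (ts i).relabel (Sum.map Empty.elim id)
  | _, .imp φ ψ => .imp (embed φ) (embed ψ)
  | _, .all φ => .all (embed φ)

/-- Derivability from `T` in a Hilbert calculus for classical first-order logic with equality. -/
inductive Derives (T : arith.Theory) : arith.Formula ℕ → Prop
  | ax (σ : arith.Sentence) : σ ∈ T → Derives T (embed σ)
  | weakening (φ ψ : arith.Formula ℕ) : Derives T (φ ⟹ ψ ⟹ φ)
  | distribution (φ ψ χ : arith.Formula ℕ) :
      Derives T ((φ ⟹ ψ ⟹ χ) ⟹ (φ ⟹ ψ) ⟹ φ ⟹ χ)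
  | doubleNegation (φ : arith.Formula ℕ) : Derives T (∼∼φ ⟹ φ)
  | modusPonens (φ ψ : arith.Formula ℕ) : Derives T (φ ⟹ ψ) → Derives T φ → Derives T ψ
  | instantiation (φ : arith.BoundedFormula ℕ 1) (t : arith.Term ℕ) :
      Derives T (∀' φ ⟹ inst t φ)
  | generalization (ψ : arith.Formula ℕ) (φ : arith.BoundedFormula ℕ 1) (a : ℕ) :
      a ∉ ψ.freeVarFinset → a ∉ φ.freeVarFinset →
      Derives T (ψ ⟹ inst (fvar a) φ) → Derives T (ψ ⟹ ∀' φ)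
  | eqRefl (t : arith.Term ℕ) : Derives T (eqn t t)
  | eqSubst (φ : arith.BoundedFormula ℕ 1) (s t : arith.Term ℕ) :
      Derives T (eqn s t ⟹ inst s φ ⟹ inst t φ)

/-- `T` proves the sentence `σ`. -/
def Proves (T : arith.Theory) (σ : arith.Sentence) : Prop := Derives T (embed σ)

/-! ### Peano arithmetic -/

/-- In a term, replace the outermost bound variable `x` by `S x`. -/
def succTerm {n : ℕ} (s : arith.Term (ℕ ⊕ Fin (n + 1))) : arith.Term (ℕ ⊕ Fin (n + 1)) :=
  s.subst (Sum.elim (fun a => .var (.inl a))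
    (Fin.cases (succ (.var (.inr 0))) fun i => .var (.inr i.succ)))

/-- In a formula, replace the outermost bound variable `x` by `S x`. For
`φ : arith.BoundedFormula ℕ 1`, this is `φ(S x)`. -/
def succInst : {n : ℕ} → arith.BoundedFormula ℕ (n + 1) → arith.BoundedFormula ℕ (n + 1)
  | _, .falsum => .falsum
  | _, .equal s₁ s₂ => .equal (succTerm s₁) (succTerm s₂)
  | _, .rel R ts => .rel R fun i => succTerm (ts i)
  | _, .imp φ ψ => .imp (succInst φ) (succInst ψ)
  | _, .all φ => .all (succInst φ)

/-- The axioms of Peano arithmetic; free variables stand for universally quantified ones, so that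
the induction formula may have parameters. -/
inductive IsPeanoAxiom : arith.Formula ℕ → Prop
  | succ_ne_zero : IsPeanoAxiom (∼(eqn (succ (fvar 0)) 0))
  | succ_inj : IsPeanoAxiom
      (eqn (succ (fvar 0)) (succ (fvar 1)) ⟹ eqn (fvar 0) (fvar 1))
  | add_zero : IsPeanoAxiom (eqn (fvar 0 + 0) (fvar 0))
  | add_succ : IsPeanoAxiom (eqn (fvar 0 + succ (fvar 1)) (succ (fvar 0 + fvar 1)))
  | mul_zero : IsPeanoAxiom (eqn (fvar 0 * 0) 0)
  | mul_succ : IsPeanoAxiom (eqn (fvar 0 * succ (fvar 1)) (fvar 0 * fvar 1 + fvar 0))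
  | induction (φ : arith.BoundedFormula ℕ 1) :
      IsPeanoAxiom (inst 0 φ ⟹ (∀' (φ ⟹ succInst φ)) ⟹ ∀' φ)

/-- `T` contains Peano arithmetic: every axiom of Peano arithmetic is a theorem of `T`. -/
def ContainsPA (T : arith.Theory) : Prop := ∀ φ, IsPeanoAxiom φ → Derives T φ

/-! ### The arithmetical sentence expressing `K(x) ≥ n` -/

/-- Terms with (at most) `n` variables. -/
abbrev Tm (n : ℕ) : Type := arith.Term (Empty ⊕ Fin n)

/-- Formulas with (at most) `n` free variables. -/
abbrev Fm (n : ℕ) : Type := arith.BoundedFormula Empty n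

/-- A term, seen in a context with one more variable. -/
def up {n : ℕ} (t : Tm n) : Tm (n + 1) := t.relabel (Sum.map id Fin.castSucc)

/-- A term, seen in a context with two more variables. -/
abbrev up2 {n : ℕ} (t : Tm n) : Tm (n + 2) := up (up t)

/-- A term, seen in a context with three more variables. -/
abbrev up3 {n : ℕ} (t : Tm n) : Tm (n + 3) := up (up2 t)

/-- A term, seen in a context with four more variables. -/
abbrev up4 {n : ℕ} (t : Tm n) : Tm (n + 4) := up (up3 t)

/-- `∃ a, f a`. -/
def ex {n : ℕ} (f : Tm (n + 1) → Fm (n + 1)) : Fm n := ∃' (f (.var (.inr (Fin.last n))))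

/-- `∀ a, f a`. -/
def al {n : ℕ} (f : Tm (n + 1) → Fm (n + 1)) : Fm n := ∀' (f (.var (.inr (Fin.last n))))

/-- `x < y`. -/
def lt {n : ℕ} (x y : Tm n) : Fm n := ex fun z => (up x + succ z) =' up y

/-- `∀ i < m, f i`. -/
def alLt {n : ℕ} (m : Tm n) (f : Tm (n + 1) → Fm (n + 1)) : Fm n :=
  al fun i => lt i (up m) ⟹ f i

/-- `z = Nat.pair x y`. -/
def isPair {n : ℕ} (x y z : Tm n) : Fm n :=
  (lt x y ⊓ z =' (y * y + x)) ⊔ (∼(lt x y) ⊓ z =' (x * x + x + y))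

/-- `v = s mod ((i + 1) * t + 1)`, Gödel's beta function: the `i`-th term of the sequence coded by
`s` and `t` is `v`. -/
def isBeta {n : ℕ} (s t i v : Tm n) : Fm n :=
  lt v (succ (succ i * t)) ⊓ ex fun q => up s =' (q * up (succ (succ i * t)) + up v)

/-- There is a sequence `c₀, …, c_m` with `base c₀`, with `step i cᵢ cᵢ₊₁` for all `i < m`, and with
`c_m = y`. -/
def iter {n : ℕ} (base : Tm (n + 3) → Fm (n + 3))
    (step : Tm (n + 5) → Tm (n + 5) → Tm (n + 5) → Fm (n + 5)) (m y : Tm n) : Fm n :=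
  ex fun s => ex fun t =>
    (ex fun v => isBeta (up2 s) (up t) 0 v ⊓ base v) ⊓
    (alLt (up2 m) fun i => ex fun c => ex fun d =>
      isBeta (up4 s) (up3 t) (up2 i) (up c) ⊓ isBeta (up4 s) (up3 t) (succ (up2 i)) d ⊓
        step (up2 i) (up c) d) ⊓
    isBeta (up s) t (up2 m) (up2 y)

/-- `y = 2 ^ e`. -/
def isPow2 {n : ℕ} (e y : Tm n) : Fm n :=
  iter (fun c => c =' succ 0) (fun _ c d => d =' (c + c)) e y

/-- `y` is the output of the algorithm `u` on input `x`. -/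
def graph : Code → {n : ℕ} → Tm n → Tm n → Fm n
  | .zero, _, _, y => y =' 0
  | .succ, _, x, y => y =' succ x
  | .left, _, x, y => ex fun z => isPair (up y) z (up x)
  | .right, _, x, y => ex fun z => isPair z (up y) (up x)
  | .pair f g, _, x, y => ex fun a => ex fun b =>
      graph f (up2 x) (up a) ⊓ graph g (up2 x) b ⊓ isPair (up a) b (up2 y)
  | .comp f g, _, x, y => ex fun a => graph g (up x) a ⊓ graph f a (up y)
  | .prec f g, _, x, y => ex fun a => ex fun m => isPair (up a) m (up2 x) ⊓
      iter (fun c => graph f (up3 (up a)) c)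
        (fun i c d => ex fun w => ex fun z =>
          isPair (up2 i) (up2 c) (up w) ⊓ isPair (up2 (up4 (up2 a))) (up w) z ⊓ graph g z (up2 d))
        m (up2 y)
  | .rfind' f, _, x, y => ex fun a => ex fun m => ex fun k =>
      isPair (up2 a) (up m) (up3 x) ⊓ (up3 y =' (k + up m)) ⊓
      (ex fun z => isPair (up3 a) (up4 y) z ⊓ graph f z 0) ⊓
      (alLt k fun i => ex fun z => ex fun w =>
        isPair (up (up4 a)) (up2 i + up4 m) (up z) ⊓ graph f (up z) (succ w))

/-- `K(x) ≥ n`: no program `p` of length `< n`, that is with `strNum p + 1 < 2 ^ n`, has output `x`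
under the algorithm `u`. -/
def kGe {m : ℕ} (u : Code) (x n : Tm m) : Fm m :=
  al fun p => (ex fun y => isPow2 (up2 n) y ⊓ lt (succ (up p)) y) ⟹ ∼(graph u p (up x))

/-- The arithmetical sentence `K(x) ≥ n`, for a string `x` and a natural number `n`, where `K = K_U`
and `u` is an algorithm computing `U`. -/
def kGeSentence (u : Code) (x : List Bool) (n : ℕ) : arith.Sentence :=
  kGe (m := 0) u (num (strNum x)) (num n)

end Chaitin

namespace Chaitin

open FirstOrder FirstOrder.Language
open Nat.Partrec (Code)

/-! The proof is an effective form of Berry's paradox. If `T` proved "K(x) ≥ n" for arbitrarily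
large n, an algorithm `A` could, on input p, search through all proofs from `T` for such a sentence
with n > `strNum p` and output its x. The number of a string can be far larger than its length, so a
short input enforces a large bound. Let d be the constant with K_U ≤ K_A + d and let p be the string
of d + 1 ones. The output x has K_U(x) ≤ 2d + 1, while n > `strNum p` ≥ 2d + 2. Since the axioms of
`T` are true, so is "K(x) ≥ n", which is a contradiction. The bound enters as the input of `A`, so
no self-reference is needed.

Three ingredients carry the argument. First, the theorems of `T` can be enumerated
(`exists_primrec_enum_derives`): syntax and derivability are generated by finitely many Horn clauses
on Gödel numbers (`fact_iff_derives`), and the least set closed under such clauses is enumerated by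
a primitive recursive function of finite certificates (`horn_iff_exists_follow`). Second, the Gödel
number of "K(x) ≥ n" is primitive recursive in x and n (`primrec_formulaCode_kGeSentence`), so `A`
recognizes the sentences it looks for (`exists_partrec_search`). Third, theorems of `T` are true
(`realize_of_derives`), and a true sentence "K(x) ≥ n" really bounds program lengths
(`le_length_of_realize_kGeSentence`). For the latter, one half of the correctness of the
arithmetization suffices: by `holds_graph`, every actual computation makes its formula true. The
converse is not needed, because the computation occurs negated in "K(x) ≥ n". -/

/-! ### Horn clauses over the natural numbers -/

/-- Patterns for natural numbers. -/
inductive Pat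
  | var (i : ℕ)
  | const (k : ℕ)
  | inc (p : Pat)
  | pair (p q : Pat)

/-- The value of a pattern under an assignment of its variables. -/
def Pat.eval (e : List ℕ) : Pat → ℕ
  | .var i => e.getD i 0
  | .const k => k
  | .inc p => p.eval e + 1
  | .pair p q => Nat.pair (p.eval e) (q.eval e)

theorem Pat.primrec_eval (p : Pat) : Primrec fun e => p.eval e := by
  induction p with
  | var i => exact (Primrec.list_getD 0).comp Primrec.id (Primrec.const i)
  | const k => exact Primrec.const k
  | inc p ih => exact Primrec.succ.comp ih
  | pair p q ihp ihq => exact Primrec₂.natPair.comp ihp ihq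

/-- A Horn clause: premises and a conclusion. -/
abbrev Clause : Type := List Pat × Pat

/-- The least set of natural numbers that contains `B` and is closed under the clauses in `C`. -/
inductive Horn (B : ℕ → Prop) (C : List Clause) : ℕ → Prop
  | base (k : ℕ) : B k → Horn B C k
  | step (c : Clause) (e : List ℕ) : c ∈ C → (∀ p ∈ c.1, Horn B C (p.eval e)) →
      Horn B C (c.2.eval e)

/-- Whether all the premises `ps`, under the assignment `e`, are in the list `l`. -/
def holdsIn (l e : List ℕ) : List Pat → Bool
  | [] => true
  | p :: ps => decide (∃ a ∈ l, a = p.eval e) && holdsIn l e ps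

theorem holdsIn_iff {l e : List ℕ} {ps : List Pat} :
    holdsIn l e ps = true ↔ ∀ p ∈ ps, p.eval e ∈ l := by
  induction ps with
  | nil => simp [holdsIn]
  | cons p ps ih => simp [holdsIn, ih]

theorem primrec_holdsIn (ps : List Pat) :
    Primrec fun a : List ℕ × List ℕ => holdsIn a.1 a.2 ps := by
  induction ps with
  | nil => exact Primrec.const true
  | cons p ps ih =>
    refine Primrec.and.comp ?_ ih
    exact PrimrecPred.decide (Primrec.eq.exists_mem_list.comp Primrec.fst
      (p.primrec_eval.comp Primrec.snd))

/-- The list `l` together with all the conclusions obtained by applying the clauses in `C` under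
the assignment `e` to premises in `l`. -/
def applyClauses (l e : List ℕ) : List Clause → List ℕ
  | [] => l
  | c :: C => cond (holdsIn l e c.1) (c.2.eval e :: applyClauses l e C) (applyClauses l e C)

theorem mem_applyClauses {l e : List ℕ} {C : List Clause} {k : ℕ} :
    k ∈ applyClauses l e C ↔
      k ∈ l ∨ ∃ c ∈ C, (∀ p ∈ c.1, p.eval e ∈ l) ∧ k = c.2.eval e := by
  induction C with
  | nil => simp [applyClauses]
  | cons c C ih =>
    rw [applyClauses]
    cases h : holdsIn l e c.1
    · have h' : ¬ ∀ p ∈ c.1, p.eval e ∈ l := fun H => by simp [holdsIn_iff.2 H] at h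
      simp [ih, h']
    · have h' := holdsIn_iff.1 h
      simp only [cond_true, List.mem_cons, ih]
      constructor
      · rintro (h | h | ⟨d, hd, h⟩)
        · exact Or.inr ⟨c, Or.inl rfl, h', h⟩
        · exact Or.inl h
        · exact Or.inr ⟨d, Or.inr hd, h⟩
      · rintro (hk | ⟨d, rfl | hd, hk⟩)
        · exact Or.inr (Or.inl hk)
        · exact Or.inl hk.2
        · exact Or.inr (Or.inr ⟨d, hd, hk⟩)

theorem primrec_applyClauses (C : List Clause) :
    Primrec fun a : List ℕ × List ℕ => applyClauses a.1 a.2 C := by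
  induction C with
  | nil => exact Primrec.fst
  | cons c C ih =>
    exact Primrec.cond (primrec_holdsIn c.1)
      (Primrec.list_cons.comp (c.2.primrec_eval.comp Primrec.snd) ih) ih

/-- The facts obtained by following a list of instructions, each of them consisting of a number of
a base fact to be added and of an assignment under which the clauses are to be applied. -/
def follow (g : ℕ → Option ℕ) (C : List Clause) (h : List (ℕ × List ℕ)) : List ℕ :=
  h.foldr (fun i l => (g i.1).elim (applyClauses l i.2 C) (· :: applyClauses l i.2 C)) []

theorem primrec_follow {g : ℕ → Option ℕ} (hg : Primrec g) (C : List Clause) :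
    Primrec (follow g C) := by
  have hstep : Primrec fun s : (ℕ × List ℕ) × List ℕ => applyClauses s.2 s.1.2 C :=
    (primrec_applyClauses C).comp (Primrec.snd.pair (Primrec.snd.comp Primrec.fst))
  have h : Primrec fun s : (ℕ × List ℕ) × List ℕ =>
      (g s.1.1).elim (applyClauses s.2 s.1.2 C) (· :: applyClauses s.2 s.1.2 C) := by
    refine (Primrec.option_casesOn (hg.comp (Primrec.fst.comp Primrec.fst)) hstep
      (g := fun s a => a :: applyClauses s.2 s.1.2 C)
      (Primrec.list_cons.comp Primrec.snd (hstep.comp Primrec.fst))).of_eq fun s => ?_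
    cases g s.1.1 <;> rfl
  exact Primrec.list_foldr Primrec.id (Primrec.const []) (h.comp Primrec.snd).to₂

/-- The fold runs from the right, so the head of the list is the instruction executed last. This
unfolding is all that is used about `follow` afterwards. -/
theorem mem_follow_cons {g : ℕ → Option ℕ} {C : List Clause} {i : ℕ × List ℕ}
    {h : List (ℕ × List ℕ)} {k : ℕ} :
    k ∈ follow g C (i :: h) ↔ g i.1 = some k ∨ k ∈ follow g C h ∨
      ∃ c ∈ C, (∀ p ∈ c.1, p.eval i.2 ∈ follow g C h) ∧ k = c.2.eval i.2 := by
  change k ∈ (g i.1).elim (applyClauses (follow g C h) i.2 C)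
    (· :: applyClauses (follow g C h) i.2 C) ↔ _
  cases g i.1 <;> simp [mem_applyClauses, eq_comm]

theorem follow_append_right {g : ℕ → Option ℕ} {C : List Clause} (h₁ : List (ℕ × List ℕ))
    {h₂ : List (ℕ × List ℕ)} {k : ℕ} (hk : k ∈ follow g C h₂) : k ∈ follow g C (h₁ ++ h₂) := by
  induction h₁ with
  | nil => exact hk
  | cons i h ih => exact mem_follow_cons.2 (Or.inr (Or.inl ih))

/-- Starting from additional facts loses nothing, since clauses have only positive premises. -/
theorem follow_append_left {g : ℕ → Option ℕ} {C : List Clause} {h₁ : List (ℕ × List ℕ)}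
    (h₂ : List (ℕ × List ℕ)) : ∀ {k : ℕ}, k ∈ follow g C h₁ → k ∈ follow g C (h₁ ++ h₂) := by
  induction h₁ with
  | nil => simp [follow]
  | cons i h ih =>
    intro k hk
    rcases mem_follow_cons.1 hk with hk | hk | ⟨c, hc, hp, hk⟩
    · exact mem_follow_cons.2 (Or.inl hk)
    · exact mem_follow_cons.2 (Or.inr (Or.inl (ih hk)))
    · exact mem_follow_cons.2 (Or.inr (Or.inr ⟨c, hc, fun p h => ih (hp p h), hk⟩))

/-- A derivation tree is flattened into a linear certificate: certificates of the premises are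
concatenated, and one more instruction applies the clause. -/
theorem horn_iff_exists_follow {B : ℕ → Prop} {C : List Clause} {g : ℕ → Option ℕ}
    (hg : ∀ k, B k ↔ ∃ i, g i = some k) {k : ℕ} :
    Horn B C k ↔ ∃ h, k ∈ follow g C h := by
  constructor
  · intro hk
    induction hk with
    | base k hk =>
      obtain ⟨i, hi⟩ := (hg k).1 hk
      exact ⟨[(i, [])], mem_follow_cons.2 (Or.inl hi)⟩
    | step c e hc _ ih =>
      have key : ∀ ps : List Pat, (∀ p ∈ ps, ∃ h, p.eval e ∈ follow g C h) →
          ∃ h, ∀ p ∈ ps, p.eval e ∈ follow g C h := by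
        intro ps
        induction ps with
        | nil => exact fun _ => ⟨[], by simp⟩
        | cons q ps ihp =>
          intro H
          obtain ⟨h₁, h₁q⟩ := H q (by simp)
          obtain ⟨h₂, h₂p⟩ := ihp fun p hp => H p (by simp [hp])
          refine ⟨h₁ ++ h₂, fun p hp => ?_⟩
          rcases List.mem_cons.1 hp with rfl | hp
          · exact follow_append_left _ h₁q
          · exact follow_append_right _ (h₂p p hp)
      obtain ⟨h, hh⟩ := key c.1 ih
      -- The index 0 only fills the slot: a base fact that it may add does no harm.
      exact ⟨(0, e) :: h, mem_follow_cons.2 (Or.inr (Or.inr ⟨c, hc, hh, rfl⟩))⟩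
  · rintro ⟨h, hk⟩
    induction h generalizing k with
    | nil => simp [follow] at hk
    | cons i h ih =>
      rcases mem_follow_cons.1 hk with hk | hk | ⟨c, hc, hp, rfl⟩
      · exact .base k ((hg k).2 ⟨_, hk⟩)
      · exact ih hk
      · exact .step c i.2 hc fun p h => ih (hp p h)

/-- A computably enumerable set of natural numbers has a primitive recursive enumeration. -/
theorem exists_primrec_enum {B : ℕ → Prop} (hB : REPred B) :
    ∃ g : ℕ → Option ℕ, Primrec g ∧ ∀ k, B k ↔ ∃ i, g i = some k := by
  have h : Nat.Partrec fun k => (Part.assert (B k) fun _ => Part.some ()).map fun _ => 0 :=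
    Partrec.nat_iff.1 (Partrec.map hB (Computable.const 0).to₂)
  obtain ⟨c, hc⟩ := Nat.Partrec.Code.exists_code.1 h
  -- Dovetailing: the index codes a step bound and a candidate k, and k is listed once the
  -- semidecision procedure halts on it within the bound.
  refine ⟨fun i => (Nat.Partrec.Code.evaln i.unpair.1 c i.unpair.2).map fun _ => i.unpair.2,
    ?_, fun k => ?_⟩
  · refine Primrec.option_map (Nat.Partrec.Code.primrec_evaln.comp (((Primrec.fst.comp
      Primrec.unpair).pair (Primrec.const c)).pair (Primrec.snd.comp Primrec.unpair))) ?_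
    exact ((Primrec.snd.comp Primrec.unpair).comp Primrec.fst).to₂
  · have h1 : B k ↔ ∃ y, y ∈ c.eval k := by
      rw [hc]
      simp [Part.mem_assert_iff]
    rw [h1]
    constructor
    · rintro ⟨y, hy⟩
      obtain ⟨s, hs⟩ := Nat.Partrec.Code.evaln_complete.1 hy
      exact ⟨Nat.pair s k, by simpa using ⟨y, hs⟩⟩
    · rintro ⟨i, hi⟩
      simp only [Option.map_eq_some_iff] at hi
      obtain ⟨y, hy, rfl⟩ := hi
      exact ⟨y, Nat.Partrec.Code.evaln_sound hy⟩

/-! ### Gödel numbers -/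

section Codes

variable {α : Type}

/-- Induction on terms of arithmetic. -/
theorem arithTerm_induction {β : Type} {P : arith.Term β → Prop}
    (var : ∀ b, P (.var b)) (zero : ∀ ts, P (.func ArithFunc.zero ts))
    (succ : ∀ ts, P (ts 0) → P (.func ArithFunc.succ ts))
    (add : ∀ ts, P (ts 0) → P (ts 1) → P (.func ArithFunc.add ts))
    (mul : ∀ ts, P (ts 0) → P (ts 1) → P (.func ArithFunc.mul ts)) (t : arith.Term β) : P t := by
  induction t with
  | var b => exact var b
  | @func l f ts ih =>
    match l, f, ts, ih with
    | _, ArithFunc.zero, ts, ih => exact zero ts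
    | _, ArithFunc.succ, ts, ih => exact succ ts (ih 0)
    | _, ArithFunc.add, ts, ih => exact add ts (ih 0) (ih 1)
    | _, ArithFunc.mul, ts, ih => exact mul ts (ih 0) (ih 1)

theorem func_zero_congr {β : Type} (ts us : Fin 0 → arith.Term β) :
    (Term.func (L := arith) ArithFunc.zero ts) = .func ArithFunc.zero us := by
  congr 1; exact Subsingleton.elim _ _

theorem func_succ_congr {β : Type} {ts us : Fin 1 → arith.Term β} (h : ts 0 = us 0) :
    (Term.func (L := arith) ArithFunc.succ ts) = .func ArithFunc.succ us := by
  congr 1; funext i; rwa [Subsingleton.elim i 0]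

theorem func_two_congr {β : Type} {ts us : Fin 2 → arith.Term β} (f : arith.Functions 2)
    (h₀ : ts 0 = us 0) (h₁ : ts 1 = us 1) : (Term.func (L := arith) f ts) = .func f us := by
  congr 1; funext i; exact Fin.cases h₀ (fun j => by rwa [Subsingleton.elim j 0]) i

variable [Encodable α] {n : ℕ}

/-- The tags 0 to 5 are distinct and `Nat.pair` is injective, so a code reveals the head of the
term. This lemma and its companions invert the coding one constructor at a time. -/
theorem termCode_eq_free {s : arith.Term (α ⊕ Fin n)} {c : ℕ} (h : termCode s = Nat.pair 0 c) :
    ∃ a, s = .var (.inl a) ∧ Encodable.encode a = c := by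
  induction s using arithTerm_induction with
  | var b => rcases b with b | b <;> simp_all [termCode]
  | _ => simp [termCode] at h

theorem termCode_eq_bound {s : arith.Term (α ⊕ Fin n)} {c : ℕ} (h : termCode s = Nat.pair 1 c) :
    ∃ i : Fin n, s = .var (.inr i) ∧ i = c := by
  induction s using arithTerm_induction with
  | var b => rcases b with b | b <;> simp_all [termCode]
  | _ => simp [termCode] at h

theorem termCode_eq_zero {s : arith.Term (α ⊕ Fin n)} {c : ℕ} (h : termCode s = Nat.pair 2 c) :
    ∃ ts, s = .func ArithFunc.zero ts ∧ c = 0 := by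
  induction s using arithTerm_induction with
  | var b => rcases b with b | b <;> simp [termCode] at h
  | zero ts => exact ⟨ts, rfl, by simpa [termCode, eq_comm] using h⟩
  | _ => simp [termCode] at h

theorem termCode_eq_succ {s : arith.Term (α ⊕ Fin n)} {c : ℕ} (h : termCode s = Nat.pair 3 c) :
    ∃ ts, s = .func ArithFunc.succ ts ∧ termCode (ts 0) = c := by
  induction s using arithTerm_induction with
  | var b => rcases b with b | b <;> simp [termCode] at h
  | succ ts => exact ⟨ts, rfl, by simpa [termCode] using h⟩
  | _ => simp [termCode] at h

theorem termCode_eq_add {s : arith.Term (α ⊕ Fin n)} {c d : ℕ}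
    (h : termCode s = Nat.pair 4 (Nat.pair c d)) :
    ∃ ts, s = .func ArithFunc.add ts ∧ termCode (ts 0) = c ∧ termCode (ts 1) = d := by
  induction s using arithTerm_induction with
  | var b => rcases b with b | b <;> simp [termCode] at h
  | add ts => exact ⟨ts, rfl, by simpa [termCode] using h⟩
  | _ => simp [termCode] at h

theorem termCode_eq_mul {s : arith.Term (α ⊕ Fin n)} {c d : ℕ}
    (h : termCode s = Nat.pair 5 (Nat.pair c d)) :
    ∃ ts, s = .func ArithFunc.mul ts ∧ termCode (ts 0) = c ∧ termCode (ts 1) = d := by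
  induction s using arithTerm_induction with
  | var b => rcases b with b | b <;> simp [termCode] at h
  | mul ts => exact ⟨ts, rfl, by simpa [termCode] using h⟩
  | _ => simp [termCode] at h

theorem termCode_injective :
    Function.Injective (termCode : arith.Term (α ⊕ Fin n) → ℕ) := by
  intro s
  induction s using arithTerm_induction with
  | var b =>
    intro s' h
    rcases b with b | b
    · obtain ⟨a, rfl, ha⟩ := termCode_eq_free h.symm
      rw [Encodable.encode_injective ha]
    · obtain ⟨a, rfl, ha⟩ := termCode_eq_bound h.symm
      rw [Fin.ext ha]
  | zero ts =>
    intro s' h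
    obtain ⟨us, rfl, -⟩ := termCode_eq_zero h.symm
    exact func_zero_congr _ _
  | succ ts ih =>
    intro s' h
    obtain ⟨us, rfl, h₀⟩ := termCode_eq_succ h.symm
    exact func_succ_congr (ih h₀.symm)
  | add ts ih₀ ih₁ =>
    intro s' h
    obtain ⟨us, rfl, h₀, h₁⟩ := termCode_eq_add h.symm
    exact func_two_congr _ (ih₀ h₀.symm) (ih₁ h₁.symm)
  | mul ts ih₀ ih₁ =>
    intro s' h
    obtain ⟨us, rfl, h₀, h₁⟩ := termCode_eq_mul h.symm
    exact func_two_congr _ (ih₀ h₀.symm) (ih₁ h₁.symm)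

theorem formulaCode_eq_falsum {φ : arith.BoundedFormula α n} {c : ℕ}
    (h : formulaCode φ = Nat.pair 0 c) : φ = .falsum ∧ c = 0 := by
  cases φ with
  | falsum => exact ⟨rfl, by simpa [formulaCode, eq_comm] using h⟩
  | rel R => exact R.elim
  | _ => simp [formulaCode] at h

theorem formulaCode_eq_equal {φ : arith.BoundedFormula α n} {c d : ℕ}
    (h : formulaCode φ = Nat.pair 1 (Nat.pair c d)) :
    ∃ s t, φ = .equal s t ∧ termCode s = c ∧ termCode t = d := by
  cases φ with
  | equal s t => exact ⟨s, t, rfl, by simpa [formulaCode] using h⟩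
  | rel R => exact R.elim
  | _ => simp [formulaCode] at h

theorem formulaCode_eq_imp {φ : arith.BoundedFormula α n} {c d : ℕ}
    (h : formulaCode φ = Nat.pair 2 (Nat.pair c d)) :
    ∃ ψ χ, φ = .imp ψ χ ∧ formulaCode ψ = c ∧ formulaCode χ = d := by
  cases φ with
  | imp ψ χ => exact ⟨ψ, χ, rfl, by simpa [formulaCode] using h⟩
  | rel R => exact R.elim
  | _ => simp [formulaCode] at h

theorem formulaCode_eq_all {φ : arith.BoundedFormula α n} {c : ℕ}
    (h : formulaCode φ = Nat.pair 3 c) : ∃ ψ, φ = .all ψ ∧ formulaCode ψ = c := by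
  cases φ with
  | all ψ => exact ⟨ψ, rfl, by simpa [formulaCode] using h⟩
  | rel R => exact R.elim
  | _ => simp [formulaCode] at h

/-- This allows a fact about a number to be read as a fact about one formula. Injectivity is for
fixed `n`: the code does not record the number of bound variables in scope. -/
theorem formulaCode_injective :
    Function.Injective (formulaCode : arith.BoundedFormula α n → ℕ) := by
  intro φ
  induction φ with
  | falsum => intro ψ h; exact (formulaCode_eq_falsum h.symm).1.symm
  | equal s t =>
    intro ψ h
    obtain ⟨s', t', rfl, hs, ht⟩ := formulaCode_eq_equal h.symm
    rw [termCode_injective hs, termCode_injective ht]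
  | rel R => exact R.elim
  | imp φ ψ ihφ ihψ =>
    intro χ h
    obtain ⟨φ', ψ', rfl, hφ, hψ⟩ := formulaCode_eq_imp h.symm
    rw [ihφ hφ.symm, ihψ hψ.symm]
  | all φ ih =>
    intro χ h
    obtain ⟨φ', rfl, hφ⟩ := formulaCode_eq_all h.symm
    rw [ih hφ.symm]

end Codes

/-! ### Invariance of codes under changes of context -/

theorem termCode_embed {n : ℕ} (s : arith.Term (Empty ⊕ Fin n)) :
    termCode (s.relabel (Sum.map (Empty.elim : Empty → ℕ) id)) = termCode s := by
  induction s using arithTerm_induction with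
  | var b => rcases b with b | b; exacts [b.elim, rfl]
  | zero ts => rfl
  | succ ts ih => simp [Term.relabel, termCode, ih]
  | add ts ih₀ ih₁ => simp [Term.relabel, termCode, ih₀, ih₁]
  | mul ts ih₀ ih₁ => simp [Term.relabel, termCode, ih₀, ih₁]

theorem formulaCode_embed {n : ℕ} (φ : arith.BoundedFormula Empty n) :
    formulaCode (embed φ) = formulaCode φ := by
  induction φ with
  | falsum => rfl
  | equal s t => simp [embed, formulaCode, termCode_embed]
  | rel R => exact R.elim
  | imp φ ψ ihφ ihψ => simp [embed, formulaCode, ihφ, ihψ]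
  | all φ ih => simp [embed, formulaCode, ih]

/-- The Gödel number of a term without bound variables. -/
def freeTermCode (t : arith.Term ℕ) : ℕ :=
  termCode (t.relabel Sum.inl : arith.Term (ℕ ⊕ Fin 0))

/-- A term without bound variables has the same code in every context, so substituting it under
quantifiers needs no shifting of codes. -/
theorem termCode_relabel_inl {n : ℕ} (t : arith.Term ℕ) :
    termCode (t.relabel Sum.inl : arith.Term (ℕ ⊕ Fin n)) = freeTermCode t := by
  unfold freeTermCode
  induction t using arithTerm_induction with
  | var b => rfl
  | zero ts => rfl
  | succ ts ih => simp [Term.relabel, termCode, ih]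
  | add ts ih₀ ih₁ => simp [Term.relabel, termCode, ih₀, ih₁]
  | mul ts ih₀ ih₁ => simp [Term.relabel, termCode, ih₀, ih₁]

theorem exists_freeTermCode_eq (s : arith.Term (ℕ ⊕ Fin 0)) :
    ∃ t, freeTermCode t = termCode s := by
  refine ⟨s.relabel (Sum.elim id Fin.elim0), ?_⟩
  unfold freeTermCode
  rw [Term.relabel_relabel]
  congr 1
  convert Term.relabel_id s using 2
  funext a
  rcases a with a | a
  exacts [rfl, a.elim0]

/-! ### Syntax and derivability as a system of Horn clauses

A fact is a natural number whose first component tells which relation it is about. -/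

/-- The number `c` is the code of a term with `n` bound variables. -/
def IsTermCode (n c : ℕ) : Prop := ∃ t : arith.Term (ℕ ⊕ Fin n), termCode t = c

/-- The number `c` is the code of a formula with `n` bound variables. -/
def IsFormulaCode (n c : ℕ) : Prop := ∃ φ : arith.BoundedFormula ℕ n, formulaCode φ = c

/-- The variable `a` is not in any term with code `c`. -/
def IsFreshForTerm (a c : ℕ) : Prop :=
  ∀ (n : ℕ) (t : arith.Term (ℕ ⊕ Fin n)), termCode t = c → a ∉ t.varFinsetLeft

/-- The variable `a` is not free in any formula with code `c`. -/
def IsFreshForFormula (a c : ℕ) : Prop :=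
  ∀ (n : ℕ) (φ : arith.BoundedFormula ℕ n), formulaCode φ = c → a ∉ φ.freeVarFinset

/-- Instances of the terms with code `c` at terms with code `d` have code `r`. -/
def IsInstTermCode (d c r : ℕ) : Prop :=
  ∀ (n : ℕ) (s : arith.Term (ℕ ⊕ Fin (n + 1))) (t : arith.Term ℕ),
    freeTermCode t = d → termCode s = c → termCode (instTerm t s) = r

/-- Instances of the formulas with code `c` at terms with code `d` have code `r`. -/
def IsInstFormulaCode (d c r : ℕ) : Prop :=
  ∀ (n : ℕ) (φ : arith.BoundedFormula ℕ (n + 1)) (t : arith.Term ℕ),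
    freeTermCode t = d → formulaCode φ = c → formulaCode (inst t φ) = r

/-- The number `c` is the code of a formula derivable from `T`. -/
def IsDerivableCode (T : arith.Theory) (c : ℕ) : Prop :=
  ∃ φ, Derives T φ ∧ formulaCode φ = c

/-- The number `k`, read as a fact, is true. -/
def IsTrueFact (T : arith.Theory) (k : ℕ) : Prop :=
  match k.unpair.1 with
  | 0 => k.unpair.2.unpair.2 < k.unpair.2.unpair.1
  | 1 => IsTermCode k.unpair.2.unpair.1 k.unpair.2.unpair.2
  | 2 => IsFormulaCode k.unpair.2.unpair.1 k.unpair.2.unpair.2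
  | 3 => k.unpair.2.unpair.1 ≠ k.unpair.2.unpair.2
  | 4 => IsFreshForTerm k.unpair.2.unpair.1 k.unpair.2.unpair.2
  | 5 => IsFreshForFormula k.unpair.2.unpair.1 k.unpair.2.unpair.2
  | 6 => IsInstTermCode k.unpair.2.unpair.1 k.unpair.2.unpair.2.unpair.1
      k.unpair.2.unpair.2.unpair.2
  | 7 => IsInstFormulaCode k.unpair.2.unpair.1 k.unpair.2.unpair.2.unpair.1
      k.unpair.2.unpair.2.unpair.2
  | 8 => IsDerivableCode T k.unpair.2
  | _ => False

namespace Pat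

/-- The fact with tag `k` about two numbers. -/
def fact₂ (k : ℕ) (p q : Pat) : Pat := pair (const k) (pair p q)

/-- The fact with tag `k` about three numbers. -/
def fact₃ (k : ℕ) (p q r : Pat) : Pat := pair (const k) (pair p (pair q r))

/-- The fact that `p` is the code of a derivable formula. -/
def der (p : Pat) : Pat := pair (const 8) p

/-- The code of an equation. -/
def eq (p q : Pat) : Pat := pair (const 1) (pair p q)

/-- The code of an implication. -/
def imp (p q : Pat) : Pat := pair (const 2) (pair p q)

/-- The code of a universal formula. -/
def all (p : Pat) : Pat := pair (const 3) p

/-- The code of the false formula. -/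
def falsum : Pat := pair (const 0) (const 0)

end Pat

open Pat

/-- Clauses for `i < n`, for codes of terms and for `a ≠ b`. -/
def termClauses : List Clause :=
  [([], fact₂ 0 (inc (var 0)) (const 0)),
   ([fact₂ 0 (var 0) (var 1)], fact₂ 0 (inc (var 0)) (inc (var 1))),
   ([], fact₂ 1 (var 0) (pair (const 0) (var 1))),
   ([fact₂ 0 (var 0) (var 1)], fact₂ 1 (var 0) (pair (const 1) (var 1))),
   ([], fact₂ 1 (var 0) (pair (const 2) (const 0))),
   ([fact₂ 1 (var 0) (var 1)], fact₂ 1 (var 0) (pair (const 3) (var 1))),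
   ([fact₂ 1 (var 0) (var 1), fact₂ 1 (var 0) (var 2)],
      fact₂ 1 (var 0) (pair (const 4) (pair (var 1) (var 2)))),
   ([fact₂ 1 (var 0) (var 1), fact₂ 1 (var 0) (var 2)],
      fact₂ 1 (var 0) (pair (const 5) (pair (var 1) (var 2)))),
   ([], fact₂ 3 (const 0) (inc (var 0))),
   ([], fact₂ 3 (inc (var 0)) (const 0)),
   ([fact₂ 3 (var 0) (var 1)], fact₂ 3 (inc (var 0)) (inc (var 1)))]

/-- Clauses for codes of formulas. -/
def formulaClauses : List Clause :=
  [([], fact₂ 2 (var 0) falsum),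
   ([fact₂ 1 (var 0) (var 1), fact₂ 1 (var 0) (var 2)],
      fact₂ 2 (var 0) (eq (var 1) (var 2))),
   ([fact₂ 2 (var 0) (var 1), fact₂ 2 (var 0) (var 2)],
      fact₂ 2 (var 0) (imp (var 1) (var 2))),
   ([fact₂ 2 (inc (var 0)) (var 1)], fact₂ 2 (var 0) (all (var 1)))]

/-- Clauses for variables that do not occur. -/
def freshClauses : List Clause :=
  [([fact₂ 3 (var 0) (var 1)], fact₂ 4 (var 0) (pair (const 0) (var 1))),
   ([], fact₂ 4 (var 0) (pair (const 1) (var 1))),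
   ([], fact₂ 4 (var 0) (pair (const 2) (const 0))),
   ([fact₂ 4 (var 0) (var 1)], fact₂ 4 (var 0) (pair (const 3) (var 1))),
   ([fact₂ 4 (var 0) (var 1), fact₂ 4 (var 0) (var 2)],
      fact₂ 4 (var 0) (pair (const 4) (pair (var 1) (var 2)))),
   ([fact₂ 4 (var 0) (var 1), fact₂ 4 (var 0) (var 2)],
      fact₂ 4 (var 0) (pair (const 5) (pair (var 1) (var 2)))),
   ([], fact₂ 5 (var 0) falsum),
   ([fact₂ 4 (var 0) (var 1), fact₂ 4 (var 0) (var 2)],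
      fact₂ 5 (var 0) (eq (var 1) (var 2))),
   ([fact₂ 5 (var 0) (var 1), fact₂ 5 (var 0) (var 2)],
      fact₂ 5 (var 0) (imp (var 1) (var 2))),
   ([fact₂ 5 (var 0) (var 1)], fact₂ 5 (var 0) (all (var 1)))]

/-- Clauses for instances. -/
def instClauses : List Clause :=
  [([], fact₃ 6 (var 0) (pair (const 0) (var 1)) (pair (const 0) (var 1))),
   ([], fact₃ 6 (var 0) (pair (const 1) (const 0)) (var 0)),
   ([], fact₃ 6 (var 0) (pair (const 1) (inc (var 1))) (pair (const 1) (var 1))),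
   ([], fact₃ 6 (var 0) (pair (const 2) (const 0)) (pair (const 2) (const 0))),
   ([fact₃ 6 (var 0) (var 1) (var 2)],
      fact₃ 6 (var 0) (pair (const 3) (var 1)) (pair (const 3) (var 2))),
   ([fact₃ 6 (var 0) (var 1) (var 2), fact₃ 6 (var 0) (var 3) (var 4)],
      fact₃ 6 (var 0) (pair (const 4) (pair (var 1) (var 3)))
        (pair (const 4) (pair (var 2) (var 4)))),
   ([fact₃ 6 (var 0) (var 1) (var 2), fact₃ 6 (var 0) (var 3) (var 4)],
      fact₃ 6 (var 0) (pair (const 5) (pair (var 1) (var 3)))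
        (pair (const 5) (pair (var 2) (var 4)))),
   ([], fact₃ 7 (var 0) falsum falsum),
   ([fact₃ 6 (var 0) (var 1) (var 2), fact₃ 6 (var 0) (var 3) (var 4)],
      fact₃ 7 (var 0) (eq (var 1) (var 3)) (eq (var 2) (var 4))),
   ([fact₃ 7 (var 0) (var 1) (var 2), fact₃ 7 (var 0) (var 3) (var 4)],
      fact₃ 7 (var 0) (imp (var 1) (var 3)) (imp (var 2) (var 4))),
   ([fact₃ 7 (var 0) (var 1) (var 2)], fact₃ 7 (var 0) (all (var 1)) (all (var 2)))]

/-- Clauses for derivability. -/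
def derivationClauses : List Clause :=
  [([fact₂ 2 (const 0) (var 0), fact₂ 2 (const 0) (var 1)],
      der (imp (var 0) (imp (var 1) (var 0)))),
   ([fact₂ 2 (const 0) (var 0), fact₂ 2 (const 0) (var 1), fact₂ 2 (const 0) (var 2)],
      der (imp (imp (var 0) (imp (var 1) (var 2)))
        (imp (imp (var 0) (var 1)) (imp (var 0) (var 2))))),
   ([fact₂ 2 (const 0) (var 0)], der (imp (imp (imp (var 0) falsum) falsum) (var 0))),
   ([der (imp (var 0) (var 1)), der (var 0)], der (var 1)),
   ([fact₂ 2 (const 1) (var 0), fact₂ 1 (const 0) (var 1), fact₃ 7 (var 1) (var 0) (var 2)],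
      der (imp (all (var 0)) (var 2))),
   ([fact₂ 2 (const 0) (var 0), fact₂ 2 (const 1) (var 1), fact₂ 5 (var 3) (var 0),
      fact₂ 5 (var 3) (var 1), fact₃ 7 (pair (const 0) (var 3)) (var 1) (var 2),
      der (imp (var 0) (var 2))], der (imp (var 0) (all (var 1)))),
   ([fact₂ 1 (const 0) (var 0)], der (eq (var 0) (var 0))),
   ([fact₂ 2 (const 1) (var 0), fact₂ 1 (const 0) (var 1), fact₂ 1 (const 0) (var 2),
      fact₃ 7 (var 1) (var 0) (var 3), fact₃ 7 (var 2) (var 0) (var 4)],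
      der (imp (eq (var 1) (var 2)) (imp (var 3) (var 4))))]

/-- All the clauses. -/
def clauses : List Clause :=
  termClauses ++ (formulaClauses ++ (freshClauses ++ (instClauses ++ derivationClauses)))

/-- The facts about the axioms of `T`. -/
def IsAxiomFact (T : arith.Theory) (k : ℕ) : Prop :=
  k.unpair.1 = 8 ∧ ∃ σ : arith.Sentence, σ ∈ T ∧ formulaCode σ = k.unpair.2

/-- The facts that can be derived. -/
abbrev Fact (T : arith.Theory) : ℕ → Prop := Horn (IsAxiomFact T) clauses

/-! #### Only true facts can be derived -/

/-- The clause `c` preserves the truth of facts. -/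
def IsSoundClause (T : arith.Theory) (c : Clause) : Prop :=
  ∀ e, (∀ p ∈ c.1, IsTrueFact T (p.eval e)) → IsTrueFact T (c.2.eval e)

theorem isSoundClause_of_mem_termClauses (T : arith.Theory) :
    ∀ c ∈ termClauses, IsSoundClause T c := by
  simp only [termClauses, List.forall_mem_cons, IsSoundClause, IsTrueFact, Pat.eval, fact₂,
    Nat.unpair_pair, List.not_mem_nil, false_imp_iff, imp_true_iff, and_true,
    forall_const]
  refine ⟨fun e => by omega, fun e h => by omega, fun e => ⟨.var (.inl _), rfl⟩, ?_,
    fun e => ⟨.func ArithFunc.zero Fin.elim0, rfl⟩, ?_, ?_, ?_, fun e => by omega,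
    fun e => by omega, fun e h => by omega⟩
  · exact fun e h => ⟨.var (.inr ⟨_, h⟩), rfl⟩
  · rintro e ⟨t, ht⟩
    exact ⟨.func ArithFunc.succ ![t], by simp [termCode, ht]⟩
  · rintro e ⟨⟨s, hs⟩, ⟨t, ht⟩⟩
    exact ⟨.func ArithFunc.add ![s, t], by simp [termCode, hs, ht]⟩
  · rintro e ⟨⟨s, hs⟩, ⟨t, ht⟩⟩
    exact ⟨.func ArithFunc.mul ![s, t], by simp [termCode, hs, ht]⟩

theorem isSoundClause_of_mem_formulaClauses (T : arith.Theory) :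
    ∀ c ∈ formulaClauses, IsSoundClause T c := by
  simp only [formulaClauses, List.forall_mem_cons, IsSoundClause, IsTrueFact, Pat.eval, fact₂,
    Nat.unpair_pair, List.not_mem_nil, false_imp_iff, imp_true_iff, and_true,
    forall_const, Pat.eq, Pat.imp, Pat.all, Pat.falsum]
  refine ⟨fun e => ⟨.falsum, rfl⟩, ?_, ?_, ?_⟩
  · rintro e ⟨⟨s, hs⟩, ⟨t, ht⟩⟩
    exact ⟨.equal s t, by simp [formulaCode, hs, ht]⟩
  · rintro e ⟨⟨s, hs⟩, ⟨t, ht⟩⟩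
    exact ⟨.imp s t, by simp [formulaCode, hs, ht]⟩
  · rintro e ⟨t, ht⟩
    exact ⟨.all t, by simp [formulaCode, ht]⟩

theorem mem_varFinsetLeft_func {n l : ℕ} (f : arith.Functions l)
    (ts : Fin l → arith.Term (ℕ ⊕ Fin n)) (a : ℕ) :
    a ∈ (Term.func f ts).varFinsetLeft ↔ ∃ i, a ∈ (ts i).varFinsetLeft := by
  simp [Term.varFinsetLeft]

/-- Freshness is stated for all objects with a given code, so it holds vacuously for numbers that
code nothing. This is why these clauses need not test whether their arguments are codes; each case
inverts the code and uses the premises. -/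
theorem isSoundClause_of_mem_freshClauses (T : arith.Theory) :
    ∀ c ∈ freshClauses, IsSoundClause T c := by
  simp only [freshClauses, List.forall_mem_cons, IsSoundClause, IsTrueFact, Pat.eval, fact₂,
    Nat.unpair_pair, List.not_mem_nil, false_imp_iff, imp_true_iff, and_true,
    forall_const, Pat.eq, Pat.imp, Pat.all, Pat.falsum]
  refine ⟨?_, ?_, ?_, ?_, ?_, ?_, ?_, ?_, ?_, ?_⟩
  · intro e h n t ht
    obtain ⟨a, rfl, ha⟩ := termCode_eq_free ht
    rw [Encodable.encode_nat] at ha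
    simpa [Term.varFinsetLeft, ha] using h
  · intro e n t ht
    obtain ⟨a, rfl, -⟩ := termCode_eq_bound ht
    simp [Term.varFinsetLeft]
  · intro e n t ht
    obtain ⟨ts, rfl, -⟩ := termCode_eq_zero ht
    refine (not_congr (mem_varFinsetLeft_func _ _ _)).2 ?_
    exact fun ⟨i, _⟩ => i.elim0
  · intro e h n t ht
    obtain ⟨ts, rfl, h₀⟩ := termCode_eq_succ ht
    refine (not_congr (mem_varFinsetLeft_func _ _ _)).2 ?_
    simpa using h n _ h₀
  · intro e h n t ht
    obtain ⟨ts, rfl, h₀, h₁⟩ := termCode_eq_add ht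
    refine (not_congr (mem_varFinsetLeft_func _ _ _)).2 ?_
    simpa using ⟨h.1 n _ h₀, h.2 n _ h₁⟩
  · intro e h n t ht
    obtain ⟨ts, rfl, h₀, h₁⟩ := termCode_eq_mul ht
    refine (not_congr (mem_varFinsetLeft_func _ _ _)).2 ?_
    simpa using ⟨h.1 n _ h₀, h.2 n _ h₁⟩
  · intro e n φ hφ
    obtain ⟨rfl, -⟩ := formulaCode_eq_falsum hφ
    simp [BoundedFormula.freeVarFinset]
  · intro e h n φ hφ
    obtain ⟨s, t, rfl, hs, ht⟩ := formulaCode_eq_equal hφ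
    simpa [BoundedFormula.freeVarFinset] using ⟨h.1 n _ hs, h.2 n _ ht⟩
  · intro e h n φ hφ
    obtain ⟨s, t, rfl, hs, ht⟩ := formulaCode_eq_imp hφ
    simpa [BoundedFormula.freeVarFinset] using ⟨h.1 n _ hs, h.2 n _ ht⟩
  · intro e h n φ hφ
    obtain ⟨s, rfl, hs⟩ := formulaCode_eq_all hφ
    simpa [BoundedFormula.freeVarFinset] using h _ _ hs

/-- Bound variable 0 is the outermost one and becomes the substituted term; every other index drops
by one. The context size is universally quantified in these facts, so the case of `∀'` can use the
premise one level deeper. -/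
theorem isSoundClause_of_mem_instClauses (T : arith.Theory) :
    ∀ c ∈ instClauses, IsSoundClause T c := by
  simp only [instClauses, List.forall_mem_cons, IsSoundClause, IsTrueFact, Pat.eval, fact₃,
    Nat.unpair_pair, List.not_mem_nil, false_imp_iff, imp_true_iff, and_true,
    forall_const, Pat.eq, Pat.imp, Pat.all, Pat.falsum]
  refine ⟨?_, ?_, ?_, ?_, ?_, ?_, ?_, ?_, ?_, ?_, ?_⟩
  · intro e n s t _ hs
    obtain ⟨a, rfl, ha⟩ := termCode_eq_free hs
    exact hs
  · intro e n s t ht hs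
    obtain ⟨i, rfl, hi⟩ := termCode_eq_bound hs
    obtain rfl : i = 0 := Fin.ext hi
    simpa [instTerm, Term.subst, termCode_relabel_inl] using ht
  · intro e n s t ht hs
    obtain ⟨i, rfl, hi⟩ := termCode_eq_bound hs
    induction i using Fin.cases with
    | zero => simp at hi
    | succ i => simpa [instTerm, Term.subst, termCode] using hi
  · intro e n s t _ hs
    obtain ⟨ts, rfl, -⟩ := termCode_eq_zero hs
    rfl
  · intro e h n s t ht hs
    obtain ⟨ts, rfl, h₀⟩ := termCode_eq_succ hs
    simpa [instTerm, Term.subst, termCode] using h n _ t ht h₀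
  · intro e h n s t ht hs
    obtain ⟨ts, rfl, h₀, h₁⟩ := termCode_eq_add hs
    simpa [instTerm, Term.subst, termCode] using ⟨h.1 n _ t ht h₀, h.2 n _ t ht h₁⟩
  · intro e h n s t ht hs
    obtain ⟨ts, rfl, h₀, h₁⟩ := termCode_eq_mul hs
    simpa [instTerm, Term.subst, termCode] using ⟨h.1 n _ t ht h₀, h.2 n _ t ht h₁⟩
  · intro e n φ t _ hφ
    obtain ⟨rfl, -⟩ := formulaCode_eq_falsum hφ
    simp [inst, formulaCode]
  · intro e h n φ t ht hφ
    obtain ⟨s₁, s₂, rfl, h₁, h₂⟩ := formulaCode_eq_equal hφ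
    simpa [inst, formulaCode] using ⟨h.1 n _ t ht h₁, h.2 n _ t ht h₂⟩
  · intro e h n φ t ht hφ
    obtain ⟨s₁, s₂, rfl, h₁, h₂⟩ := formulaCode_eq_imp hφ
    simpa [inst, formulaCode] using ⟨h.1 n _ t ht h₁, h.2 n _ t ht h₂⟩
  · intro e h n φ t ht hφ
    obtain ⟨s, rfl, h₁⟩ := formulaCode_eq_all hφ
    simpa [inst, formulaCode] using h _ _ t ht h₁

/-- Here the premises with tags 1 and 2 matter: they provide actual terms and formulas to which a
rule of the calculus applies. Injectivity of the coding identifies formulas arising from different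
premises. -/
theorem isSoundClause_of_mem_derivationClauses (T : arith.Theory) :
    ∀ c ∈ derivationClauses, IsSoundClause T c := by
  simp only [derivationClauses, List.forall_mem_cons, IsSoundClause, IsTrueFact, Pat.eval, fact₂,
    fact₃, Nat.unpair_pair, List.not_mem_nil, false_imp_iff, imp_true_iff, and_true,
    Pat.eq, Pat.imp, Pat.all, Pat.falsum, der]
  refine ⟨?_, ?_, ?_, ?_, ?_, ?_, ?_, ?_⟩
  · rintro e ⟨⟨φ, hφ⟩, ψ, hψ⟩
    exact ⟨_, .weakening φ ψ, by simp only [formulaCode, hφ, hψ]⟩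
  · rintro e ⟨⟨φ, hφ⟩, ⟨ψ, hψ⟩, χ, hχ⟩
    exact ⟨_, .distribution φ ψ χ, by simp only [formulaCode, hφ, hψ, hχ]⟩
  · rintro e ⟨φ, hφ⟩
    exact ⟨_, .doubleNegation φ, by simp only [formulaCode, hφ]⟩
  · rintro e ⟨⟨χ, hχ, h⟩, φ, hφ, h'⟩
    obtain ⟨φ', ψ, rfl, h₁, h₂⟩ := formulaCode_eq_imp h
    obtain rfl := formulaCode_injective (h₁.trans h'.symm)
    exact ⟨ψ, .modusPonens _ _ hχ hφ, h₂⟩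
  · rintro e ⟨⟨φ, hφ⟩, ⟨s, hs⟩, h⟩
    obtain ⟨t, ht⟩ := exists_freeTermCode_eq s
    exact ⟨_, .instantiation φ t, by simp only [formulaCode, hφ, h 0 φ t (ht.trans hs) hφ]⟩
  · rintro e ⟨⟨ψ, hψ⟩, ⟨φ, hφ⟩, h₁, h₂, h, χ, hχ, h'⟩
    obtain ⟨ψ', θ, rfl, h₃, h₄⟩ := formulaCode_eq_imp h'
    obtain rfl := formulaCode_injective (h₃.trans hψ.symm)
    -- The pattern `pair (const 0) (var 3)` evaluates to the code of a free variable, hence the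
    -- `rfl`.
    obtain rfl := formulaCode_injective (h₄.trans (h 0 φ (fvar _) rfl hφ).symm)
    exact ⟨_, .generalization ψ' φ _ (h₁ 0 ψ' hψ) (h₂ 1 φ hφ) hχ,
      by simp only [formulaCode, hφ, hψ]⟩
  · rintro e ⟨s, hs⟩
    obtain ⟨t, ht⟩ := exists_freeTermCode_eq s
    refine ⟨_, .eqRefl t, ?_⟩
    change Nat.pair 1 (Nat.pair (freeTermCode t) (freeTermCode t)) = _
    rw [ht, hs]
  · rintro e ⟨⟨φ, hφ⟩, ⟨s, hs⟩, ⟨t, ht⟩, h₁, h₂⟩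
    obtain ⟨s', hs'⟩ := exists_freeTermCode_eq s
    obtain ⟨t', ht'⟩ := exists_freeTermCode_eq t
    refine ⟨_, .eqSubst φ s' t', ?_⟩
    change Nat.pair 2 (Nat.pair (Nat.pair 1 (Nat.pair (freeTermCode s') (freeTermCode t')))
      (Nat.pair 2 (Nat.pair (formulaCode (inst s' φ)) (formulaCode (inst t' φ))))) = _
    rw [h₁ 0 φ s' (hs'.trans hs) hφ, h₂ 0 φ t' (ht'.trans ht) hφ, hs', hs, ht', ht]

theorem isTrueFact_of_fact {T : arith.Theory} {k : ℕ} (h : Fact T k) : IsTrueFact T k := by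
  induction h with
  | base k hk =>
    obtain ⟨h8, σ, hσ, h⟩ := hk
    simp only [IsTrueFact, h8]
    exact ⟨_, .ax σ hσ, (formulaCode_embed σ).trans h⟩
  | step c e hc _ ih =>
    simp only [clauses, List.mem_append] at hc
    rcases hc with hc | hc | hc | hc | hc
    exacts [isSoundClause_of_mem_termClauses T c hc e ih,
      isSoundClause_of_mem_formulaClauses T c hc e ih,
      isSoundClause_of_mem_freshClauses T c hc e ih,
      isSoundClause_of_mem_instClauses T c hc e ih,
      isSoundClause_of_mem_derivationClauses T c hc e ih]

/-! #### All true facts can be derived -/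

section

variable {T : arith.Theory}

/-- In each application, `i` is the position of the clause in its list and `e` gives the values of
its variables. Folding the premises into a conjunction lets their proofs be supplied as one tuple
ending in `trivial`. -/
theorem Fact.of_clause {C : List Clause} (hC : C ⊆ clauses) (i : ℕ) (e : List ℕ) {c : Clause}
    (hc : C[i]? = some c) (h : c.1.foldr (fun p P => Fact T (p.eval e) ∧ P) True) :
    Fact T (c.2.eval e) := by
  refine .step c e (hC (List.mem_of_getElem? hc)) ?_
  revert h
  induction c.1 with
  | nil => simp
  | cons p ps ih => exact fun h => List.forall_mem_cons.2 ⟨h.1, ih h.2⟩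

theorem termClauses_subset : termClauses ⊆ clauses := fun _ h => by simp [clauses, h]
theorem formulaClauses_subset : formulaClauses ⊆ clauses := fun _ h => by simp [clauses, h]
theorem freshClauses_subset : freshClauses ⊆ clauses := fun _ h => by simp [clauses, h]
theorem instClauses_subset : instClauses ⊆ clauses := fun _ h => by simp [clauses, h]
theorem derivationClauses_subset : derivationClauses ⊆ clauses := fun _ h => by simp [clauses, h]

theorem fact_lt {i n : ℕ} (h : i < n) : Fact T (Nat.pair 0 (Nat.pair n i)) := by
  induction i generalizing n with
  | zero =>
    obtain ⟨n, rfl⟩ := Nat.exists_eq_succ_of_ne_zero h.ne'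
    exact Fact.of_clause termClauses_subset 0 [n] rfl trivial
  | succ i ih =>
    obtain ⟨n, rfl⟩ := Nat.exists_eq_succ_of_ne_zero (Nat.ne_zero_of_lt h)
    exact Fact.of_clause termClauses_subset 1 [n, i] rfl ⟨ih (Nat.lt_of_succ_lt_succ h), trivial⟩

theorem fact_ne {a b : ℕ} (h : a ≠ b) : Fact T (Nat.pair 3 (Nat.pair a b)) := by
  induction a generalizing b with
  | zero =>
    obtain ⟨b, rfl⟩ := Nat.exists_eq_succ_of_ne_zero h.symm
    exact Fact.of_clause termClauses_subset 8 [b] rfl trivial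
  | succ a ih =>
    cases b with
    | zero => exact Fact.of_clause termClauses_subset 9 [a] rfl trivial
    | succ b =>
      exact Fact.of_clause termClauses_subset 10 [a, b] rfl ⟨ih (ne_of_apply_ne (· + 1) h), trivial⟩

theorem fact_isTerm {n : ℕ} (t : arith.Term (ℕ ⊕ Fin n)) :
    Fact T (Nat.pair 1 (Nat.pair n (termCode t))) := by
  induction t using arithTerm_induction with
  | var b =>
    rcases b with a | i
    · exact Fact.of_clause termClauses_subset 2 [n, a] rfl trivial
    · exact Fact.of_clause termClauses_subset 3 [n, i] rfl ⟨fact_lt i.2, trivial⟩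
  | zero ts => exact Fact.of_clause termClauses_subset 4 [n] rfl trivial
  | succ ts ih =>
    exact Fact.of_clause termClauses_subset 5 [n, termCode (ts 0)] rfl ⟨ih, trivial⟩
  | add ts ih₀ ih₁ =>
    exact Fact.of_clause termClauses_subset 6 [n, termCode (ts 0), termCode (ts 1)] rfl
      ⟨ih₀, ih₁, trivial⟩
  | mul ts ih₀ ih₁ =>
    exact Fact.of_clause termClauses_subset 7 [n, termCode (ts 0), termCode (ts 1)] rfl
      ⟨ih₀, ih₁, trivial⟩

theorem fact_isFormula {n : ℕ} (φ : arith.BoundedFormula ℕ n) :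
    Fact T (Nat.pair 2 (Nat.pair n (formulaCode φ))) := by
  induction φ with
  | @falsum n =>
    simp only [formulaCode]
    exact Fact.of_clause formulaClauses_subset 0 [n] rfl trivial
  | @equal n s t =>
    simp only [formulaCode]
    exact Fact.of_clause formulaClauses_subset 1 [n, termCode s, termCode t] rfl
      ⟨fact_isTerm s, fact_isTerm t, trivial⟩
  | rel R => exact R.elim
  | @imp n φ ψ ihφ ihψ =>
    simp only [formulaCode]
    exact Fact.of_clause formulaClauses_subset 2 [n, formulaCode φ, formulaCode ψ] rfl
      ⟨ihφ, ihψ, trivial⟩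
  | @all n φ ih =>
    simp only [formulaCode]
    exact Fact.of_clause formulaClauses_subset 3 [n, formulaCode φ] rfl ⟨ih, trivial⟩

theorem fact_freshTerm {n a : ℕ} (t : arith.Term (ℕ ⊕ Fin n)) (h : a ∉ t.varFinsetLeft) :
    Fact T (Nat.pair 4 (Nat.pair a (termCode t))) := by
  induction t using arithTerm_induction with
  | var b =>
    rcases b with b | i
    · have h : a ≠ b := by simpa [Term.varFinsetLeft] using h
      exact Fact.of_clause freshClauses_subset 0 [a, b] rfl ⟨fact_ne h, trivial⟩
    · exact Fact.of_clause freshClauses_subset 1 [a, i] rfl trivial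
  | zero ts => exact Fact.of_clause freshClauses_subset 2 [a] rfl trivial
  | succ ts ih =>
    have h := not_exists.1 ((not_congr (mem_varFinsetLeft_func _ _ _)).1 h)
    exact Fact.of_clause freshClauses_subset 3 [a, termCode (ts 0)] rfl ⟨ih (h 0), trivial⟩
  | add ts ih₀ ih₁ =>
    have h := not_exists.1 ((not_congr (mem_varFinsetLeft_func _ _ _)).1 h)
    exact Fact.of_clause freshClauses_subset 4 [a, termCode (ts 0), termCode (ts 1)] rfl
      ⟨ih₀ (h 0), ih₁ (h 1), trivial⟩
  | mul ts ih₀ ih₁ =>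
    have h := not_exists.1 ((not_congr (mem_varFinsetLeft_func _ _ _)).1 h)
    exact Fact.of_clause freshClauses_subset 5 [a, termCode (ts 0), termCode (ts 1)] rfl
      ⟨ih₀ (h 0), ih₁ (h 1), trivial⟩

theorem fact_freshFormula {n a : ℕ} (φ : arith.BoundedFormula ℕ n) (h : a ∉ φ.freeVarFinset) :
    Fact T (Nat.pair 5 (Nat.pair a (formulaCode φ))) := by
  induction φ with
  | falsum =>
    simp only [formulaCode]
    exact Fact.of_clause freshClauses_subset 6 [a] rfl trivial
  | equal s t =>
    simp only [formulaCode]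
    simp only [BoundedFormula.freeVarFinset, Finset.mem_union, not_or] at h
    exact Fact.of_clause freshClauses_subset 7 [a, termCode s, termCode t] rfl
      ⟨fact_freshTerm s h.1, fact_freshTerm t h.2, trivial⟩
  | rel R => exact R.elim
  | imp φ ψ ihφ ihψ =>
    simp only [formulaCode]
    simp only [BoundedFormula.freeVarFinset, Finset.mem_union, not_or] at h
    exact Fact.of_clause freshClauses_subset 8 [a, formulaCode φ, formulaCode ψ] rfl
      ⟨ihφ h.1, ihψ h.2, trivial⟩
  | all φ ih =>
    simp only [formulaCode]
    exact Fact.of_clause freshClauses_subset 9 [a, formulaCode φ] rfl ⟨ih h, trivial⟩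

theorem fact_instTerm {n : ℕ} (t : arith.Term ℕ) (s : arith.Term (ℕ ⊕ Fin (n + 1))) :
    Fact T (Nat.pair 6 (Nat.pair (freeTermCode t)
      (Nat.pair (termCode s) (termCode (instTerm t s))))) := by
  induction s using arithTerm_induction with
  | var b =>
    rcases b with a | i
    · exact Fact.of_clause instClauses_subset 0 [freeTermCode t, a] rfl trivial
    · induction i using Fin.cases with
      | zero =>
        have h : termCode (instTerm t (.var (.inr (0 : Fin (n + 1))))) = freeTermCode t := by
          simpa [instTerm, Term.subst] using termCode_relabel_inl t
        rw [h]
        exact Fact.of_clause instClauses_subset 1 [freeTermCode t] rfl trivial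
      | succ i => exact Fact.of_clause instClauses_subset 2 [freeTermCode t, i] rfl trivial
  | zero ts => exact Fact.of_clause instClauses_subset 3 [freeTermCode t] rfl trivial
  | succ ts ih =>
    exact Fact.of_clause instClauses_subset 4
      [freeTermCode t, termCode (ts 0), termCode (instTerm t (ts 0))] rfl ⟨ih, trivial⟩
  | add ts ih₀ ih₁ =>
    exact Fact.of_clause instClauses_subset 5
      [freeTermCode t, termCode (ts 0), termCode (instTerm t (ts 0)), termCode (ts 1),
        termCode (instTerm t (ts 1))] rfl ⟨ih₀, ih₁, trivial⟩
  | mul ts ih₀ ih₁ =>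
    exact Fact.of_clause instClauses_subset 6
      [freeTermCode t, termCode (ts 0), termCode (instTerm t (ts 0)), termCode (ts 1),
        termCode (instTerm t (ts 1))] rfl ⟨ih₀, ih₁, trivial⟩

theorem fact_inst (t : arith.Term ℕ) :
    ∀ {n : ℕ} (φ : arith.BoundedFormula ℕ (n + 1)),
      Fact T (Nat.pair 7 (Nat.pair (freeTermCode t)
        (Nat.pair (formulaCode φ) (formulaCode (inst t φ)))))
  | _, .falsum => by
    simp only [inst, formulaCode]
    exact Fact.of_clause instClauses_subset 7 [freeTermCode t] rfl trivial
  | _, .equal s₁ s₂ => by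
    simp only [inst, formulaCode]
    exact Fact.of_clause instClauses_subset 8
      [freeTermCode t, termCode s₁, termCode (instTerm t s₁), termCode s₂,
        termCode (instTerm t s₂)] rfl ⟨fact_instTerm t s₁, fact_instTerm t s₂, trivial⟩
  | _, .rel R _ => R.elim
  | _, .imp φ ψ => by
    simp only [inst, formulaCode]
    exact Fact.of_clause instClauses_subset 9
      [freeTermCode t, formulaCode φ, formulaCode (inst t φ), formulaCode ψ,
        formulaCode (inst t ψ)] rfl ⟨fact_inst t φ, fact_inst t ψ, trivial⟩
  | _, .all φ => by
    simp only [inst, formulaCode]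
    exact Fact.of_clause instClauses_subset 10
      [freeTermCode t, formulaCode φ, formulaCode (inst t φ)] rfl ⟨fact_inst t φ, trivial⟩

theorem fact_derives {φ : arith.Formula ℕ} (h : Derives T φ) :
    Fact T (Nat.pair 8 (formulaCode φ)) := by
  induction h with
  | ax σ hσ =>
    refine .base _ ⟨by simp, σ, hσ, ?_⟩
    rw [Nat.unpair_pair, formulaCode_embed]
  | weakening φ ψ =>
    simp only [formulaCode]
    exact Fact.of_clause derivationClauses_subset 0 [formulaCode φ, formulaCode ψ] rfl
      ⟨fact_isFormula φ, fact_isFormula ψ, trivial⟩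
  | distribution φ ψ χ =>
    simp only [formulaCode]
    exact Fact.of_clause derivationClauses_subset 1
      [formulaCode φ, formulaCode ψ, formulaCode χ] rfl
      ⟨fact_isFormula φ, fact_isFormula ψ, fact_isFormula χ, trivial⟩
  | doubleNegation φ =>
    simp only [formulaCode]
    exact Fact.of_clause derivationClauses_subset 2 [formulaCode φ] rfl
      ⟨fact_isFormula φ, trivial⟩
  | modusPonens φ ψ _ _ ih₁ ih₂ =>
    simp only [formulaCode] at ih₁
    exact Fact.of_clause derivationClauses_subset 3 [formulaCode φ, formulaCode ψ] rfl
      ⟨ih₁, ih₂, trivial⟩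
  | instantiation φ t =>
    simp only [formulaCode]
    exact Fact.of_clause derivationClauses_subset 4
      [formulaCode φ, freeTermCode t, formulaCode (inst t φ)] rfl
      ⟨fact_isFormula φ, fact_isTerm _, fact_inst t φ, trivial⟩
  | generalization ψ φ a h₁ h₂ _ ih =>
    simp only [formulaCode] at ih ⊢
    exact Fact.of_clause derivationClauses_subset 5
      [formulaCode ψ, formulaCode φ, formulaCode (inst (fvar a) φ), a] rfl
      ⟨fact_isFormula ψ, fact_isFormula φ, fact_freshFormula ψ h₁, fact_freshFormula φ h₂,
        fact_inst (fvar a) φ, ih, trivial⟩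
  | eqRefl t =>
    exact Fact.of_clause derivationClauses_subset 6 [freeTermCode t] rfl ⟨fact_isTerm _, trivial⟩
  | eqSubst φ s t =>
    simp only [formulaCode]
    exact Fact.of_clause derivationClauses_subset 7
      [formulaCode φ, freeTermCode s, freeTermCode t, formulaCode (inst s φ),
        formulaCode (inst t φ)] rfl
      ⟨fact_isFormula φ, fact_isTerm _, fact_isTerm _, fact_inst s φ, fact_inst t φ, trivial⟩

/-- A formula is derivable if and only if the corresponding fact is. -/
theorem fact_iff_derives {φ : arith.Formula ℕ} :
    Fact T (Nat.pair 8 (formulaCode φ)) ↔ Derives T φ := by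
  refine ⟨fun h => ?_, fact_derives⟩
  obtain ⟨ψ, hψ, h⟩ : IsDerivableCode T (formulaCode φ) := by
    simpa only [IsTrueFact, Nat.unpair_pair] using isTrueFact_of_fact h
  rwa [← formulaCode_injective h]

end

/-! ### The Gödel number of the sentence `K(x) ≥ n` is computable -/

/-- Bound variables are numbered from the outermost quantifier inwards, so a new innermost variable
does not renumber the others. -/
theorem termCode_up {n : ℕ} (t : Tm n) : termCode (up t) = termCode t := by
  unfold up
  induction t using arithTerm_induction with
  | var b => rcases b with b | b; exacts [b.elim, rfl]
  | zero ts => rfl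
  | succ ts ih => simp [Term.relabel, termCode, ih]
  | add ts ih₀ ih₁ => simp [Term.relabel, termCode, ih₀, ih₁]
  | mul ts ih₀ ih₁ => simp [Term.relabel, termCode, ih₀, ih₁]

section

variable {P : Type} [Primcodable P] {n : ℕ}

/-- The Gödel number of the term `t p` is a primitive recursive function of `p`. -/
def PrimrecTerm (t : P → Tm n) : Prop := Primrec fun p => termCode (t p)

/-- The Gödel number of the formula `φ p` is a primitive recursive function of `p`. -/
def PrimrecFormula (φ : P → Fm n) : Prop := Primrec fun p => formulaCode (φ p)

theorem PrimrecTerm.const (t : Tm n) : PrimrecTerm fun _ : P => t := Primrec.const _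

theorem PrimrecTerm.up {t : P → Tm n} (ht : PrimrecTerm t) : PrimrecTerm fun p => up (t p) := by
  simpa only [PrimrecTerm, termCode_up] using ht

theorem PrimrecTerm.up2 {t : P → Tm n} (ht : PrimrecTerm t) : PrimrecTerm fun p => up2 (t p) :=
  ht.up.up

theorem PrimrecTerm.up3 {t : P → Tm n} (ht : PrimrecTerm t) : PrimrecTerm fun p => up3 (t p) :=
  ht.up2.up

theorem PrimrecTerm.up4 {t : P → Tm n} (ht : PrimrecTerm t) : PrimrecTerm fun p => up4 (t p) :=
  ht.up3.up

theorem PrimrecTerm.succ {t : P → Tm n} (ht : PrimrecTerm t) :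
    PrimrecTerm fun p => succ (t p) :=
  Primrec₂.natPair.comp (Primrec.const 3) ht

theorem PrimrecTerm.add {s t : P → Tm n} (hs : PrimrecTerm s) (ht : PrimrecTerm t) :
    PrimrecTerm fun p => s p + t p :=
  Primrec₂.natPair.comp (Primrec.const 4) (Primrec₂.natPair.comp hs ht)

theorem PrimrecTerm.mul {s t : P → Tm n} (hs : PrimrecTerm s) (ht : PrimrecTerm t) :
    PrimrecTerm fun p => s p * t p :=
  Primrec₂.natPair.comp (Primrec.const 5) (Primrec₂.natPair.comp hs ht)

theorem PrimrecTerm.num {f : P → ℕ} (hf : Primrec f) :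
    PrimrecTerm fun p => (num (f p) : Tm n) := by
  have h : ∀ k, termCode (Chaitin.num k : Tm n) =
      Nat.rec (Nat.pair 2 0) (fun _ c => Nat.pair 3 c) k := by
    intro k
    induction k with
    | zero => rfl
    | succ k ih => simp [← ih, Chaitin.num, Chaitin.succ, termCode, Functions.apply₁]
  have h' : Primrec fun k => termCode (Chaitin.num k : Tm n) := by
    simp only [h]
    exact Primrec.nat_rec₁ _ (Primrec₂.natPair.comp (Primrec.const 3) Primrec.snd).to₂
  exact h'.comp hf

theorem PrimrecFormula.equal {s t : P → Tm n} (hs : PrimrecTerm s) (ht : PrimrecTerm t) :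
    PrimrecFormula fun p => s p =' t p := by
  unfold PrimrecFormula
  simp only [Term.bdEqual, formulaCode]
  exact Primrec₂.natPair.comp (Primrec.const 1) (Primrec₂.natPair.comp hs ht)

theorem PrimrecFormula.imp {φ ψ : P → Fm n} (hφ : PrimrecFormula φ) (hψ : PrimrecFormula ψ) :
    PrimrecFormula fun p => φ p ⟹ ψ p := by
  unfold PrimrecFormula
  simp only [formulaCode]
  exact Primrec₂.natPair.comp (Primrec.const 2) (Primrec₂.natPair.comp hφ hψ)

theorem PrimrecFormula.all {φ : P → Fm (n + 1)} (hφ : PrimrecFormula φ) :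
    PrimrecFormula fun p => ∀' φ p := by
  unfold PrimrecFormula
  simp only [formulaCode]
  exact Primrec₂.natPair.comp (Primrec.const 3) hφ

theorem PrimrecFormula.not {φ : P → Fm n} (hφ : PrimrecFormula φ) :
    PrimrecFormula fun p => ∼(φ p) :=
  hφ.imp (Primrec.const _)

theorem PrimrecFormula.and {φ ψ : P → Fm n} (hφ : PrimrecFormula φ) (hψ : PrimrecFormula ψ) :
    PrimrecFormula fun p => φ p ⊓ ψ p :=
  (hφ.imp hψ.not).not

theorem PrimrecFormula.or {φ ψ : P → Fm n} (hφ : PrimrecFormula φ) (hψ : PrimrecFormula ψ) :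
    PrimrecFormula fun p => φ p ⊔ ψ p :=
  hφ.not.imp hψ

/-- The body is a function of the bound variable as a term. Asking for the hypothesis at every
primitive recursive family of terms lets nested bodies be treated by the same rules; it is applied
only to the constant family. -/
theorem PrimrecFormula.ex {φ : P → Tm (n + 1) → Fm (n + 1)}
    (hφ : ∀ {t : P → Tm (n + 1)}, PrimrecTerm t → PrimrecFormula fun p => φ p (t p)) :
    PrimrecFormula fun p => ex (φ p) :=
  (hφ (PrimrecTerm.const _)).not.all.not

theorem PrimrecFormula.al {φ : P → Tm (n + 1) → Fm (n + 1)}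
    (hφ : ∀ {t : P → Tm (n + 1)}, PrimrecTerm t → PrimrecFormula fun p => φ p (t p)) :
    PrimrecFormula fun p => al (φ p) :=
  (hφ (PrimrecTerm.const _)).all

theorem PrimrecFormula.lt {s t : P → Tm n} (hs : PrimrecTerm s) (ht : PrimrecTerm t) :
    PrimrecFormula fun p => lt (s p) (t p) :=
  .ex fun hz => .equal (hs.up.add hz.succ) ht.up

theorem PrimrecFormula.alLt {m : P → Tm n} {φ : P → Tm (n + 1) → Fm (n + 1)}
    (hm : PrimrecTerm m)
    (hφ : ∀ {t : P → Tm (n + 1)}, PrimrecTerm t → PrimrecFormula fun p => φ p (t p)) :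
    PrimrecFormula fun p => alLt (m p) (φ p) :=
  .al fun hi => (PrimrecFormula.lt hi hm.up).imp (hφ hi)

theorem PrimrecFormula.isPair {x y z : P → Tm n} (hx : PrimrecTerm x) (hy : PrimrecTerm y)
    (hz : PrimrecTerm z) : PrimrecFormula fun p => isPair (x p) (y p) (z p) :=
  ((PrimrecFormula.lt hx hy).and (.equal hz ((hy.mul hy).add hx))).or
    ((PrimrecFormula.lt hx hy).not.and (.equal hz (((hx.mul hx).add hx).add hy)))

theorem PrimrecFormula.isBeta {s t i v : P → Tm n} (hs : PrimrecTerm s) (ht : PrimrecTerm t)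
    (hi : PrimrecTerm i) (hv : PrimrecTerm v) :
    PrimrecFormula fun p => isBeta (s p) (t p) (i p) (v p) :=
  (PrimrecFormula.lt hv (hi.succ.mul ht).succ).and
    (.ex fun hq => .equal hs.up ((hq.mul (hi.succ.mul ht).succ.up).add hv.up))

theorem PrimrecFormula.iter {base : P → Tm (n + 3) → Fm (n + 3)}
    {step : P → Tm (n + 5) → Tm (n + 5) → Tm (n + 5) → Fm (n + 5)} {m y : P → Tm n}
    (hbase : ∀ {c : P → Tm (n + 3)}, PrimrecTerm c → PrimrecFormula fun p => base p (c p))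
    (hstep : ∀ {i c d : P → Tm (n + 5)}, PrimrecTerm i → PrimrecTerm c → PrimrecTerm d →
      PrimrecFormula fun p => step p (i p) (c p) (d p))
    (hm : PrimrecTerm m) (hy : PrimrecTerm y) :
    PrimrecFormula fun p => iter (base p) (step p) (m p) (y p) := by
  unfold Chaitin.iter
  refine PrimrecFormula.ex fun hs => PrimrecFormula.ex fun ht => ?_
  refine PrimrecFormula.and (PrimrecFormula.and ?_ ?_) ?_
  · refine PrimrecFormula.ex fun hv => ?_
    exact PrimrecFormula.and (PrimrecFormula.isBeta hs.up2 ht.up (PrimrecTerm.const 0) hv)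
      (hbase hv)
  · refine PrimrecFormula.alLt hm.up2 fun hi => PrimrecFormula.ex fun hc =>
      PrimrecFormula.ex fun hd => ?_
    refine PrimrecFormula.and (PrimrecFormula.and ?_ ?_) (hstep hi.up2 hc.up hd)
    · exact PrimrecFormula.isBeta hs.up4 ht.up3 hi.up2 hc.up
    · exact PrimrecFormula.isBeta hs.up4 ht.up3 hi.up2.succ hd
  · exact PrimrecFormula.isBeta hs.up ht hm.up2 hy.up2

theorem PrimrecFormula.isPow2 {e y : P → Tm n} (he : PrimrecTerm e) (hy : PrimrecTerm y) :
    PrimrecFormula fun p => isPow2 (e p) (y p) :=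
  .iter (fun hc => .equal hc (.const _)) (fun _ hc hd => .equal hd (hc.add hc)) he hy

/-- The program is fixed, so the induction on it takes place outside the computation: only the terms
plugged into the formula depend on the parameter. Contexts and terms are general because subprograms
are placed under further quantifiers. -/
theorem PrimrecFormula.graph (u : Code) : ∀ {n : ℕ} {x y : P → Tm n}, PrimrecTerm x →
    PrimrecTerm y → PrimrecFormula fun p => graph u (x p) (y p) := by
  induction u with
  | zero => exact fun _ hy => .equal hy (.const 0)
  | succ => exact fun hx hy => .equal hy hx.succ
  | left => exact fun hx hy => .ex fun hz => .isPair hy.up hz hx.up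
  | right => exact fun hx hy => .ex fun hz => .isPair hz hy.up hx.up
  | pair f g ihf ihg =>
    exact fun hx hy => .ex fun ha => .ex fun hb =>
      ((ihf hx.up2 ha.up).and (ihg hx.up2 hb)).and (.isPair ha.up hb hy.up2)
  | comp f g ihf ihg => exact fun hx hy => .ex fun ha => (ihg hx.up ha).and (ihf ha hy.up)
  | prec f g ihf ihg =>
    intro n x y hx hy
    unfold Chaitin.graph
    refine PrimrecFormula.ex fun ha => PrimrecFormula.ex fun hm =>
      PrimrecFormula.and (PrimrecFormula.isPair ha.up hm hx.up2) ?_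
    refine PrimrecFormula.iter (fun hc => ihf ha.up.up3 hc) (fun hi hc hd => ?_) hm hy.up2
    refine PrimrecFormula.ex fun hw => PrimrecFormula.ex fun hz =>
      PrimrecFormula.and (PrimrecFormula.and ?_ ?_) (ihg hz hd.up2)
    · exact PrimrecFormula.isPair hi.up2 hc.up2 hw.up
    · exact PrimrecFormula.isPair ha.up2.up4.up2 hw.up hz
  | rfind' f ih =>
    intro n x y hx hy
    unfold Chaitin.graph
    refine PrimrecFormula.ex fun ha => PrimrecFormula.ex fun hm => PrimrecFormula.ex fun hk => ?_
    refine PrimrecFormula.and (PrimrecFormula.and (PrimrecFormula.and ?_ ?_) ?_) ?_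
    · exact PrimrecFormula.isPair ha.up2 hm.up hx.up3
    · exact PrimrecFormula.equal hy.up3 (hk.add hm.up)
    · exact PrimrecFormula.ex fun hz => PrimrecFormula.and
        (PrimrecFormula.isPair ha.up3 hy.up4 hz) (ih hz (PrimrecTerm.const 0))
    · refine PrimrecFormula.alLt hk fun hi => PrimrecFormula.ex fun hz =>
        PrimrecFormula.ex fun hw => PrimrecFormula.and ?_ (ih hz.up hw.succ)
      exact PrimrecFormula.isPair ha.up4.up (hi.up2.add hm.up4) hz.up

theorem PrimrecFormula.kGe (u : Code) {x k : P → Tm n} (hx : PrimrecTerm x)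
    (hk : PrimrecTerm k) : PrimrecFormula fun p => kGe u (x p) (k p) := by
  unfold Chaitin.kGe
  refine PrimrecFormula.al fun hp => PrimrecFormula.imp ?_ (PrimrecFormula.graph u hp hx.up).not
  exact PrimrecFormula.ex fun hy => PrimrecFormula.and (PrimrecFormula.isPow2 hk.up2 hy)
    (PrimrecFormula.lt hp.up.succ hy)

end

theorem primrec_strNum : Primrec strNum := by
  have h : Primrec fun l : List Bool => l.foldr (fun b k => 2 * k + 1 + b.toNat) 0 := by
    refine Primrec.list_foldr (f := fun l : List Bool => l)
      (h := fun _ s => 2 * s.2 + 1 + s.1.toNat) Primrec.id (Primrec.const 0) ?_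
    have h₁ : Primrec fun s : List Bool × Bool × ℕ => s.2.2 := Primrec.snd.comp Primrec.snd
    have h₂ : Primrec fun s : List Bool × Bool × ℕ => s.2.1.toNat :=
      (Primrec.dom_bool Bool.toNat).comp (Primrec.fst.comp Primrec.snd)
    exact (Primrec.nat_add.comp (Primrec.nat_double_succ.comp h₁) h₂).to₂
  refine h.of_eq fun l => ?_
  induction l with
  | nil => rfl
  | cons b l ih => simp [strNum, ih]

theorem primrec_formulaCode_kGeSentence (u : Code) :
    Primrec fun a : List Bool × ℕ => formulaCode (kGeSentence u a.1 a.2) :=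
  PrimrecFormula.kGe u (PrimrecTerm.num (primrec_strNum.comp Primrec.fst))
    (PrimrecTerm.num Primrec.snd)

/-! ### Soundness of the calculus in the standard model -/

theorem realize_instTerm {n : ℕ} (t : arith.Term ℕ) (s : arith.Term (ℕ ⊕ Fin (n + 1)))
    (v : ℕ → ℕ) (xs : Fin n → ℕ) :
    (instTerm t s).realize (Sum.elim v xs) =
      s.realize (Sum.elim v (Fin.cons (t.realize v) xs : Fin (n + 1) → ℕ)) := by
  rw [instTerm, Term.realize_subst]
  congr 1
  funext b
  rcases b with a | i
  · rfl
  · induction i using Fin.cases with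
    | zero => simp [Term.realize_relabel]
    | succ i => rfl

theorem realize_inst (t : arith.Term ℕ) (v : ℕ → ℕ) :
    ∀ {n : ℕ} (φ : arith.BoundedFormula ℕ (n + 1)) (xs : Fin n → ℕ),
      (inst t φ).Realize v xs ↔ φ.Realize v (Fin.cons (t.realize v) xs : Fin (n + 1) → ℕ)
  | _, .falsum, _ => by simp only [inst, BoundedFormula.Realize]
  | _, .equal s₁ s₂, _ => by simp only [inst, BoundedFormula.Realize, realize_instTerm]
  | _, .rel R _, _ => R.elim
  | _, .imp φ ψ, _ => by
    simp only [inst, BoundedFormula.Realize, realize_inst t v φ, realize_inst t v ψ]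
  | _, .all φ, xs => by
    simp only [inst, BoundedFormula.Realize, realize_inst t v φ]
    refine forall_congr' fun a => ?_
    -- The instantiated variable is first and the quantified one last in the assignment, so the two
    -- extensions commute.
    rw [Fin.cons_snoc_eq_snoc_cons]

theorem realize_embed {n : ℕ} (φ : arith.BoundedFormula Empty n) (v : ℕ → ℕ) (w : Empty → ℕ)
    (xs : Fin n → ℕ) : (embed φ).Realize v xs ↔ φ.Realize w xs := by
  have h : ∀ (n : ℕ) (s : arith.Term (Empty ⊕ Fin n)) (xs : Fin n → ℕ),
      (s.relabel (Sum.map (Empty.elim : Empty → ℕ) id)).realize (Sum.elim v xs) =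
        s.realize (Sum.elim w xs) := by
    intro n s xs
    rw [Term.realize_relabel]
    congr 1
    funext b
    rcases b with b | b
    exacts [b.elim, rfl]
  induction φ with
  | falsum => simp only [embed, BoundedFormula.Realize]
  | equal s t => simp only [embed, BoundedFormula.Realize, h]
  | rel R => exact R.elim
  | imp φ ψ ihφ ihψ => simp only [embed, BoundedFormula.Realize, ihφ, ihψ]
  | all φ ih => simp only [embed, BoundedFormula.Realize, ih]

theorem realize_term_congr {n : ℕ} (t : arith.Term (ℕ ⊕ Fin n)) {v w : ℕ → ℕ} (xs : Fin n → ℕ)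
    (h : ∀ a ∈ t.varFinsetLeft, v a = w a) :
    t.realize (Sum.elim v xs) = t.realize (Sum.elim w xs) := by
  induction t with
  | var b =>
    rcases b with b | b
    · exact h b (by simp [Term.varFinsetLeft])
    · rfl
  | func f ts ih =>
    refine congrArg (Structure.funMap f) (funext fun i => ih i fun a ha => h a ?_)
    exact (mem_varFinsetLeft_func f ts a).2 ⟨i, ha⟩

theorem realize_congr {n : ℕ} (φ : arith.BoundedFormula ℕ n) {v w : ℕ → ℕ}
    (h : ∀ a ∈ φ.freeVarFinset, v a = w a) (xs : Fin n → ℕ) :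
    φ.Realize v xs ↔ φ.Realize w xs := by
  induction φ with
  | falsum => rfl
  | equal s t =>
    simp only [BoundedFormula.freeVarFinset, Finset.mem_union] at h
    simp only [BoundedFormula.Realize]
    rw [realize_term_congr s xs fun a ha => h a (Or.inl ha),
      realize_term_congr t xs fun a ha => h a (Or.inr ha)]
  | rel R => exact R.elim
  | imp φ ψ ihφ ihψ =>
    simp only [BoundedFormula.freeVarFinset, Finset.mem_union] at h
    simp only [BoundedFormula.Realize]
    rw [ihφ (fun a ha => h a (Or.inl ha)), ihψ (fun a ha => h a (Or.inr ha))]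
  | all φ ih =>
    simp only [BoundedFormula.Realize]
    exact forall_congr' fun a => ih h _

theorem realize_eqn (s t : arith.Term ℕ) (v : ℕ → ℕ) :
    (eqn s t).Realize v ↔ s.realize v = t.realize v :=
  Formula.realize_equal

theorem realize_of_derives {T : arith.Theory} (hT : ℕ ⊨ T) {φ : arith.Formula ℕ}
    (h : Derives T φ) (v : ℕ → ℕ) : φ.Realize v := by
  induction h generalizing v with
  | ax σ hσ => exact (realize_embed σ v _ _).2 (hT.realize_of_mem σ hσ)
  | weakening φ ψ => simp only [Formula.Realize, BoundedFormula.realize_imp]; tauto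
  | distribution φ ψ χ => simp only [Formula.Realize, BoundedFormula.realize_imp]; tauto
  | doubleNegation φ =>
    simp only [Formula.Realize, BoundedFormula.realize_imp, BoundedFormula.realize_not]
    exact not_not.1
  | modusPonens φ ψ _ _ ih₁ ih₂ =>
    exact BoundedFormula.realize_imp.1 (ih₁ v) (ih₂ v)
  | instantiation φ t =>
    simp only [Formula.Realize, BoundedFormula.realize_imp, realize_inst,
      BoundedFormula.realize_all]
    intro h
    convert h (t.realize v) using 1
    funext i
    rw [Fin.fin_one_eq_zero i]
    simp [Fin.snoc]
  | generalization ψ φ a hψ hφ _ ih =>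
    simp only [Formula.Realize, BoundedFormula.realize_imp, realize_inst,
      BoundedFormula.realize_all] at ih ⊢
    intro h b
    -- The premise is evaluated with the free variable `a` set to the arbitrary value `b`; by
    -- freshness this changes the truth of neither `ψ` nor `φ`.
    have hw : ∀ c, c ≠ a → Function.update v a b c = v c := fun c hc =>
      Function.update_of_ne hc _ _
    have h₁ := ih (Function.update v a b)
      ((realize_congr ψ (fun c hc => hw c fun hca => hψ (hca ▸ hc)) _).2 h)
    have h₂ := (realize_congr φ (fun c hc => hw c fun hca => hφ (hca ▸ hc)) _).1 h₁
    convert h₂ using 1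
    funext i
    rw [Fin.fin_one_eq_zero i]
    simp [fvar, Fin.snoc]
  | eqRefl t => exact (realize_eqn t t v).2 rfl
  | eqSubst φ s t =>
    simp only [Formula.Realize, BoundedFormula.realize_imp, realize_inst]
    intro h₁ h₂
    rwa [← (realize_eqn s t v).1 h₁]

theorem realize_of_proves {T : arith.Theory} (hT : ℕ ⊨ T) {σ : arith.Sentence}
    (h : Proves T σ) : ℕ ⊨ σ :=
  (realize_embed σ default _ _).1 (realize_of_derives hT h default)

/-! ### Correctness of the arithmetization -/

section

variable {n : ℕ}

/-- The value of a term in the standard model. -/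
def val (xs : Fin n → ℕ) (t : Tm n) : ℕ := t.realize (Sum.elim default xs)

/-- Truth of a formula in the standard model. -/
def Holds (xs : Fin n → ℕ) (φ : Fm n) : Prop := φ.Realize (default : Empty → ℕ) xs

/-- An assignment extended by the value of one more variable. -/
def extend (xs : Fin n → ℕ) (a : ℕ) : Fin (n + 1) → ℕ := Fin.snoc xs a

variable (xs : Fin n → ℕ)

@[simp] theorem val_up (a : ℕ) (t : Tm n) : val (extend xs a) (up t) = val xs t := by
  rw [val, up, Term.realize_relabel]
  congr 1
  funext b
  rcases b with b | b
  · exact b.elim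
  · simp [extend]

@[simp] theorem val_last (a : ℕ) :
    val (extend xs a) (.var (.inr (Fin.last n))) = a := by
  simp [val, extend]

@[simp] theorem val_zero : val xs 0 = 0 := rfl
@[simp] theorem val_succ (t : Tm n) : val xs (succ t) = val xs t + 1 := rfl
@[simp] theorem val_add (s t : Tm n) : val xs (s + t) = val xs s + val xs t := rfl
@[simp] theorem val_mul (s t : Tm n) : val xs (s * t) = val xs s * val xs t := rfl

@[simp] theorem val_num (k : ℕ) : val xs (num k) = k := by
  induction k with
  | zero => rfl
  | succ k ih => rw [num, val_succ, ih]

@[simp] theorem holds_equal (s t : Tm n) : Holds xs (s =' t) ↔ val xs s = val xs t := Iff.rfl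

@[simp] theorem holds_imp (φ ψ : Fm n) : Holds xs (φ ⟹ ψ) ↔ (Holds xs φ → Holds xs ψ) := Iff.rfl

@[simp] theorem holds_not (φ : Fm n) : Holds xs (∼φ) ↔ ¬ Holds xs φ := Iff.rfl

@[simp] theorem holds_and (φ ψ : Fm n) : Holds xs (φ ⊓ ψ) ↔ Holds xs φ ∧ Holds xs ψ :=
  BoundedFormula.realize_inf

@[simp] theorem holds_or (φ ψ : Fm n) : Holds xs (φ ⊔ ψ) ↔ Holds xs φ ∨ Holds xs ψ :=
  BoundedFormula.realize_sup

@[simp] theorem holds_ex (f : Tm (n + 1) → Fm (n + 1)) :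
    Holds xs (ex f) ↔ ∃ a, Holds (extend xs a) (f (.var (.inr (Fin.last n)))) :=
  BoundedFormula.realize_ex

@[simp] theorem holds_al (f : Tm (n + 1) → Fm (n + 1)) :
    Holds xs (al f) ↔ ∀ a, Holds (extend xs a) (f (.var (.inr (Fin.last n)))) :=
  BoundedFormula.realize_all

@[simp] theorem holds_lt (s t : Tm n) : Holds xs (lt s t) ↔ val xs s < val xs t := by
  simp only [lt, holds_ex, holds_equal, val_add, val_up, val_succ, val_last]
  exact ⟨fun ⟨a, h⟩ => by omega, fun h => ⟨val xs t - val xs s - 1, by omega⟩⟩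

@[simp] theorem holds_alLt (m : Tm n) (f : Tm (n + 1) → Fm (n + 1)) :
    Holds xs (alLt m f) ↔
      ∀ a < val xs m, Holds (extend xs a) (f (.var (.inr (Fin.last n)))) := by
  simp [alLt]

@[simp] theorem holds_isPair (x y z : Tm n) :
    Holds xs (isPair x y z) ↔ val xs z = Nat.pair (val xs x) (val xs y) := by
  simp only [isPair, holds_or, holds_and, holds_lt, holds_equal, val_add, val_mul, holds_not,
    Nat.pair]
  split_ifs with h <;> simp [h]

theorem holds_isBeta (s t i v : Tm n) :
    Holds xs (isBeta s t i v) ↔ Nat.beta (Nat.pair (val xs s) (val xs t)) (val xs i) = val xs v := by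
  simp only [isBeta, holds_and, holds_lt, holds_ex, holds_equal, val_up, val_succ, val_mul,
    val_add, val_last, Nat.beta, Nat.unpair_pair]
  constructor
  · rintro ⟨h, q, hq⟩
    rw [hq, add_comm, Nat.add_mul_mod_self_right, Nat.mod_eq_of_lt h]
  · intro h
    refine ⟨h ▸ Nat.mod_lt _ (Nat.succ_pos _), val xs s / ((val xs i + 1) * val xs t + 1), ?_⟩
    rw [← h, Nat.div_add_mod']

/-- Gödel's β-lemma, from the Chinese remainder theorem behind `Nat.unbeta`. The coded list has m +
1 entries, so that the index m is included. -/
theorem exists_beta (f : ℕ → ℕ) (m : ℕ) :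
    ∃ s t, ∀ i ≤ m, Nat.beta (Nat.pair s t) i = f i := by
  obtain ⟨s, t, hst⟩ : ∃ s t, Nat.unbeta ((List.range (m + 1)).map f) = Nat.pair s t :=
    ⟨_, _, (Nat.pair_unpair _).symm⟩
  refine ⟨s, t, fun i hi => ?_⟩
  rw [← hst]
  simpa using Nat.beta_unbeta_coe ((List.range (m + 1)).map f) ⟨i, by simp; omega⟩

/-- The β-lemma turns a real sequence into the two numbers that the formula asks for. The
assumptions allow arbitrary `s` and `t`, since these are chosen only inside the proof. -/
theorem holds_iter {base : Tm (n + 3) → Fm (n + 3)}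
    {step : Tm (n + 5) → Tm (n + 5) → Tm (n + 5) → Fm (n + 5)} {m y : Tm n} (f : ℕ → ℕ)
    (hbase : ∀ s t, Holds (extend (extend (extend xs s) t) (f 0))
      (base (.var (.inr (Fin.last _)))))
    (hstep : ∀ s t, ∀ i < val xs m,
      Holds (extend (extend (extend (extend (extend xs s) t) i) (f i)) (f (i + 1)))
        (step (up2 (.var (.inr (Fin.last _)))) (up (.var (.inr (Fin.last _))))
          (.var (.inr (Fin.last _)))))
    (hy : val xs y = f (val xs m)) : Holds xs (iter base step m y) := by
  obtain ⟨s, t, hst⟩ := exists_beta f (val xs m)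
  simp only [iter, holds_ex, holds_and, holds_alLt, holds_isBeta, val_up, val_last, val_zero,
    val_succ]
  refine ⟨s, t, ⟨⟨f 0, hst 0 (Nat.zero_le _), hbase s t⟩, fun i hi => ?_⟩, ?_⟩
  · exact ⟨f i, f (i + 1), ⟨hst i hi.le, hst (i + 1) hi⟩, hstep s t i hi⟩
  · rw [hst _ le_rfl, hy]

theorem holds_isPow2 {e y : Tm n} (h : val xs y = 2 ^ val xs e) : Holds xs (isPow2 e y) := by
  refine holds_iter xs (fun i => 2 ^ i) (fun s t => ?_) (fun s t i _ => ?_) h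
  · simp
  · simp [pow_succ, mul_two]

/-! ### Computation histories and the truth of the formulas describing them -/

theorem exists_seq_of_mem_eval_prec {f g : Code} {a m y : ℕ}
    (h : y ∈ (Code.prec f g).eval (Nat.pair a m)) :
    ∃ s : ℕ → ℕ, s 0 ∈ f.eval a ∧ s m = y ∧
      ∀ i < m, s (i + 1) ∈ g.eval (Nat.pair a (Nat.pair i (s i))) := by
  induction m generalizing y with
  | zero =>
    rw [Code.eval_prec_zero] at h
    exact ⟨fun _ => y, h, rfl, by simp⟩
  | succ m ih =>
    rw [Code.eval_prec_succ] at h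
    obtain ⟨z, hz, hy⟩ := Part.mem_bind_iff.1 h
    obtain ⟨s, h₀, rfl, hs⟩ := ih hz
    -- The history of the first m steps is extended by the new value; earlier entries stay as they
    -- are.
    refine ⟨Function.update s (m + 1) y, ?_, by simp, fun i hi => ?_⟩
    · rwa [Function.update_of_ne (by omega)]
    · rw [Function.update_of_ne (a := i) (by omega)]
      rcases Nat.lt_succ_iff_lt_or_eq.1 hi with hi | rfl
      · rw [Function.update_of_ne (by omega)]
        exact hs i hi
      · simpa using hy

theorem exists_of_mem_eval_rfind' {f : Code} {a m y : ℕ}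
    (h : y ∈ (Code.rfind' f).eval (Nat.pair a m)) :
    ∃ k, y = k + m ∧ 0 ∈ f.eval (Nat.pair a y) ∧
      ∀ i < k, ∃ w, w + 1 ∈ f.eval (Nat.pair a (i + m)) := by
  -- The search of `rfind'` starts at m, so `k` counts the failed trials and the output is k + m. A
  -- failed trial has a nonzero value, whence the form w + 1.
  simp only [Code.eval, Nat.unpaired, Nat.unpair_pair, Part.mem_map_iff] at h
  obtain ⟨k, hk, rfl⟩ := h
  obtain ⟨h₁, h₂⟩ := Nat.mem_rfind.1 hk
  refine ⟨k, rfl, by simpa using h₁, fun i hi => ?_⟩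
  obtain ⟨w, hw, hw'⟩ := (Part.mem_map_iff _).1 (h₂ hi)
  obtain ⟨w, rfl⟩ := Nat.exists_eq_succ_of_ne_zero (of_decide_eq_false hw')
  exact ⟨w, hw⟩

/-- If the algorithm `u` has output `y` on input `x`, then this is expressed by a true formula. -/
theorem holds_graph (u : Code) : ∀ {n : ℕ} (xs : Fin n → ℕ) (x y : Tm n),
    val xs y ∈ u.eval (val xs x) → Holds xs (graph u x y) := by
  induction u with
  | zero =>
    intro n xs x y h
    simpa [graph] using Part.mem_some_iff.1 h
  | succ =>
    intro n xs x y h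
    simpa [graph, Code.eval] using h
  | left =>
    intro n xs x y h
    simp only [graph, holds_ex, holds_isPair, val_up, val_last]
    refine ⟨(val xs x).unpair.2, ?_⟩
    have h : val xs y = (val xs x).unpair.1 := by simpa [Code.eval] using h
    rw [h, Nat.pair_unpair]
  | right =>
    intro n xs x y h
    simp only [graph, holds_ex, holds_isPair, val_up, val_last]
    refine ⟨(val xs x).unpair.1, ?_⟩
    have h : val xs y = (val xs x).unpair.2 := by simpa [Code.eval] using h
    rw [h, Nat.pair_unpair]
  | pair f g ihf ihg =>
    intro n xs x y h
    simp only [graph, holds_ex, holds_and, holds_isPair, val_up, val_last]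
    obtain ⟨a, ha, b, hb, h⟩ : ∃ a ∈ f.eval (val xs x), ∃ b ∈ g.eval (val xs x),
        Nat.pair a b = val xs y := by
      simpa [Code.eval, Seq.seq] using h
    exact ⟨a, b, ⟨ihf _ _ _ (by simpa using ha), ihg _ _ _ (by simpa using hb)⟩, h.symm⟩
  | comp f g ihf ihg =>
    intro n xs x y h
    simp only [graph, holds_ex, holds_and]
    obtain ⟨a, ha, h⟩ := Part.mem_bind_iff.1 h
    exact ⟨a, ihg _ _ _ (by simpa using ha), ihf _ _ _ (by simpa using h)⟩
  | prec f g ihf ihg =>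
    intro n xs x y h
    simp only [graph, holds_ex, holds_and, holds_isPair, val_up, val_last]
    rw [← Nat.pair_unpair (val xs x)] at h
    obtain ⟨s, h₀, hm, hs⟩ := exists_seq_of_mem_eval_prec h
    refine ⟨(val xs x).unpair.1, (val xs x).unpair.2, (Nat.pair_unpair _).symm, ?_⟩
    refine holds_iter _ s (fun _ _ => ihf _ _ _ (by simpa using h₀)) (fun _ _ i hi => ?_)
      (by simpa using hm.symm)
    simp only [holds_ex, holds_and, holds_isPair, val_up, val_last]
    exact ⟨_, _, ⟨rfl, rfl⟩, ihg _ _ _ (by simpa using hs i (by simpa using hi))⟩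
  | rfind' f ih =>
    intro n xs x y h
    simp only [graph, holds_ex, holds_and, holds_isPair, holds_alLt, holds_equal, val_add, val_up,
      val_last]
    rw [← Nat.pair_unpair (val xs x)] at h
    obtain ⟨k, hy, h₀, hk⟩ := exists_of_mem_eval_rfind' h
    refine ⟨_, _, k, ⟨⟨(Nat.pair_unpair _).symm, hy⟩, _, rfl, ih _ _ _ (by simpa using h₀)⟩,
      fun i hi => ?_⟩
    obtain ⟨w, hw⟩ := hk i hi
    exact ⟨_, w, rfl, ih _ _ _ (by simpa using hw)⟩

end

/-- The largest number of a string of length L is 2^(L+1) - 2, attained when all digits are `true`.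
-/
theorem strNum_add_one_lt (p : List Bool) : strNum p + 1 < 2 ^ (p.length + 1) := by
  induction p with
  | nil => simp [strNum]
  | cons b p ih =>
    have hb : b.toNat ≤ 1 := Bool.toNat_le b
    rw [strNum, List.length_cons, pow_succ]
    omega

/-- If the sentence `K(x) ≥ n` is true, then no program of length less than `n` has output `x`. -/
theorem le_length_of_realize_kGeSentence {U : List Bool →. List Bool} {u : Code}
    (hu : Computes u U) {x : List Bool} {n : ℕ} (h : ℕ ⊨ kGeSentence u x n) {p : List Bool}
    (hp : x ∈ U p) : n ≤ p.length := by
  by_contra! hlt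
  -- The truth of a sentence involves particular empty assignments; naming them allows the passage
  -- to `Holds`.
  obtain ⟨w, xs, h'⟩ : ∃ (w : Empty → ℕ) (xs : Fin 0 → ℕ),
      BoundedFormula.Realize (kGeSentence u x n) w xs := ⟨_, _, h⟩
  obtain rfl := Subsingleton.elim w default
  change Holds xs (kGeSentence u x n) at h'
  simp only [kGeSentence, kGe, holds_al, holds_imp, holds_ex, holds_and, holds_lt, holds_not,
    val_up, val_succ, val_last] at h'
  refine h' (strNum p) ⟨2 ^ n,
    holds_isPow2 _ (by simp only [val_last, val_up, val_num]), ?_⟩ (holds_graph u _ _ _ ?_)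
  -- As |p| + 1 ≤ n, the number of `p` lies in the range over which the sentence quantifies.
  · exact (strNum_add_one_lt p).trans_le (Nat.pow_le_pow_right two_pos hlt)
  · rw [val_last, val_up, val_num, hu p]
    exact Part.mem_map strNum hp

/-! ### The incompleteness theorem -/

theorem K_le {A : List Bool →. List Bool} {x p : List Bool} (h : x ∈ A p) : K A x ≤ p.length :=
  iInf₂_le p h

theorem exists_of_K_le {A : List Bool →. List Bool} {x : List Bool} {k : ℕ} (h : K A x ≤ k) :
    ∃ p, x ∈ A p ∧ p.length ≤ k := by
  by_contra! H
  have h' : ((k + 1 : ℕ) : ℕ∞) ≤ K A x := le_iInf₂ fun p hp => by exact_mod_cast H p hp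
  have := h'.trans h
  norm_cast at this
  omega

/-- The set of theorems of `T` is enumerated by a primitive recursive function. -/
theorem exists_primrec_enum_derives {T : arith.Theory} (hT : IsComputablyEnumerable T) :
    ∃ e : List (ℕ × List ℕ) → List ℕ, Primrec e ∧
      ∀ φ, Derives T φ ↔ ∃ h, Nat.pair 8 (formulaCode φ) ∈ e h := by
  obtain ⟨g, hg, hgT⟩ := exists_primrec_enum hT
  -- Tag 8 turns the code of an axiom into the fact that it is derivable.
  have hg' : ∀ k, IsAxiomFact T k ↔ ∃ i, (g i).map (Nat.pair 8) = some k := by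
    intro k
    simp only [IsAxiomFact, hgT, Option.map_eq_some_iff]
    constructor
    · rintro ⟨h8, i, hi⟩
      exact ⟨i, _, hi, by rw [← h8, Nat.pair_unpair]⟩
    · rintro ⟨i, c, hi, rfl⟩
      simpa using ⟨i, hi⟩
  refine ⟨_, primrec_follow (Primrec.option_map hg
    (Primrec₂.natPair.comp (Primrec.const 8) Primrec.snd).to₂) clauses, fun φ => ?_⟩
  rw [← fact_iff_derives]
  exact horn_iff_exists_follow hg'

/-- If `T` proves sentences `K(x) ≥ n` with arbitrarily large `n`, then there is an algorithm which,
on input `p`, finds some `x` for which such a sentence with `n > strNum p` is provable. -/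
theorem exists_partrec_search {T : arith.Theory} (hT : IsComputablyEnumerable T) (u : Code)
    (H : ∀ c : ℕ, ∃ x n, Proves T (kGeSentence u x n) ∧ c < n) :
    ∃ A : List Bool →. List Bool, Partrec A ∧
      ∀ p, ∃ x ∈ A p, ∃ n, Proves T (kGeSentence u x n) ∧ strNum p < n := by
  obtain ⟨e, he, heT⟩ := exists_primrec_enum_derives hT
  have hproves : ∀ x n, Proves T (kGeSentence u x n) ↔
      ∃ h, Nat.pair 8 (formulaCode (kGeSentence u x n)) ∈ e h := fun x n => by
    rw [Proves, heT, formulaCode_embed]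
  -- The search runs over triples: a string, a bound and a certificate that the resulting sentence
  -- is provable. Checking a triple is primitive recursive.
  let W := (List Bool × ℕ) × List (ℕ × List ℕ)
  let R : List Bool → W → Prop := fun p w =>
    (∃ k ∈ e w.2, k = Nat.pair 8 (formulaCode (kGeSentence u w.1.1 w.1.2))) ∧ strNum p < w.1.2
  have hR : PrimrecRel R := by
    refine PrimrecPred.and ?_ ?_
    · exact Primrec.eq.exists_mem_list.comp (he.comp (Primrec.snd.comp Primrec.snd))
        (Primrec₂.natPair.comp (Primrec.const 8)
          ((primrec_formulaCode_kGeSentence u).comp (Primrec.fst.comp Primrec.snd)))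
    · exact Primrec.nat_lt.comp (primrec_strNum.comp Primrec.fst)
        (Primrec.snd.comp (Primrec.fst.comp Primrec.snd))
  let F : List Bool → ℕ → Option (List Bool) := fun p k =>
    (Encodable.decode (α := W) k).bind fun w => if R p w then some w.1.1 else none
  have hF : Primrec₂ F := by
    refine Primrec.option_bind (Primrec.decode.comp Primrec.snd) ?_
    exact Primrec.ite (hR.comp (Primrec.fst.comp Primrec.fst) Primrec.snd)
      (Primrec.option_some.comp (Primrec.fst.comp (Primrec.fst.comp Primrec.snd)))
      (Primrec.const none)
  have hF_mem : ∀ p k x, x ∈ F p k → ∃ n, Proves T (kGeSentence u x n) ∧ strNum p < n := by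
    intro p k x hx
    obtain ⟨w, -, hw⟩ := Option.mem_bind_iff.1 hx
    split_ifs at hw with hRw
    · obtain rfl : w.1.1 = x := by simpa using hw
      exact ⟨w.1.2, (hproves _ _).2 ⟨w.2, by simpa using hRw.1⟩, hRw.2⟩
    · simp at hw
  refine ⟨fun p => Nat.rfindOpt (F p), Partrec.rfindOpt hF.to_comp, fun p => ?_⟩
  obtain ⟨x, n, hxn, hn⟩ := H (strNum p)
  obtain ⟨h, hh⟩ := (hproves x n).1 hxn
  have hdom : (Nat.rfindOpt (F p)).Dom := by
    refine Nat.rfindOpt_dom.2 ⟨Encodable.encode (((x, n), h) : W), x, ?_⟩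
    have hRw : R p ((x, n), h) := ⟨⟨_, hh, rfl⟩, hn⟩
    simp only [F, Encodable.encodek, Option.bind_some, if_pos hRw, Option.mem_some_iff]
  -- The search may stop at a triple other than the one that shows its termination; `hF_mem` applies
  -- to whatever it finds.
  obtain ⟨k, hk⟩ := Nat.rfindOpt_spec (Part.get_mem hdom)
  exact ⟨_, Part.get_mem hdom, hF_mem p k _ hk⟩

end Chaitin

theorem mainTheorem3 (U : List Bool →. List Bool) (hU : Chaitin.IsOptimal U)
    (u : Nat.Partrec.Code) (hu : Chaitin.Computes u U)
    (T : Chaitin.arith.Theory) (hT : Chaitin.IsComputablyEnumerable T)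
    (hPA : Chaitin.ContainsPA T) (htrue : ℕ ⊨ T) :
    ∃ c : ℕ, ∀ (x : List Bool) (n : ℕ),
      Chaitin.Proves T (Chaitin.kGeSentence u x n) → n ≤ c := by
  by_contra! H
  obtain ⟨A, hA, hAx⟩ := Chaitin.exists_partrec_search hT u H
  obtain ⟨d, hd⟩ := hU.2 A hA
  -- This input has length d + 1 but number at least 2(d + 1), which exceeds the bound (d + 1) + d
  -- on K_U(x).
  obtain ⟨x, hx, n, hxn, hn⟩ := hAx (List.replicate (d + 1) true)
  have hKA : Chaitin.K A x ≤ (d + 1 : ℕ) := by simpa using Chaitin.K_le hx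
  have hKU : Chaitin.K U x ≤ (d + 1 + d : ℕ) := by
    refine (hd x).trans ?_
    rw [Nat.cast_add (d + 1) d]
    gcongr
  obtain ⟨q, hq, hqd⟩ := Chaitin.exists_of_K_le hKU
  -- Soundness enters here: the provable bound is a true one, so the short program `q` for `x` has
  -- length at least `n`.
  have hnq := Chaitin.le_length_of_realize_kGeSentence hu
    (Chaitin.realize_of_proves htrue hxn) hq
  -- The exact value is 2^(k+1) - 2, but this linear bound is enough.
  have hlarge : ∀ k, 2 * k ≤ Chaitin.strNum (List.replicate k true) := by
    intro k
    induction k with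
    | zero => simp
    | succ k ih =>
      simp only [List.replicate_succ, Chaitin.strNum, Bool.toNat_true]
      omega
  have := hlarge (d + 1)
  omega
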